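/- Let $G$ be a Carnot group: a simply connected nilpotent (finite-dimensional, real) Lie group whose Lie algebra $\mathfrak g$ is equipped with a stratification, i.e. a decomposition $\mathfrak g=V_1\oplus V_2\oplus\cdots\oplus V_s$ into non-trivial linear subspaces such that $[V_1,V_i]=V_{i+1}$ for every $1\le i<s$ and $[V_1,V_s]=\{0\}$, where $[V_1,V_i]$ denotes the linear span of the brackets $[X,Y]$ with $X\in V_1$, $Y\in V_i$. For $\lambda>0$ let $\delta_\lambda:\mathfrak g\to\mathfrak g$ be the linear map $\delta_\lambda(x_1+x_2+\cdots+x_s)=\lambda x_1+\lambda^2x_2+\cdots+\lambda^s x_s$ ($x_i\in V_i$), and let $D_\lambda=\exp\circ\,\delta_\lambda\circ\log:G\to G$, where $\exp:\mathfrak g\to G$ is the exponential map, which is a bijection, and $\log$ is its inverse. Let $d_G$ be a left-invariant homogeneous metric on $G$, i.e. a metric $d_G:G\times G\to[0,\infty)$ such that $d_G(zx,zy)=d_G(x,y)$ and $d_G(D_\lambda x,D_\lambda y)=\lambda\, d_G(x,y)$ for all $x,y,z\in G$ and $\lambda>0$. For $r>0$ let $B_r=\{x\in G: d_G(\mathrm{id},x)\le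 r\}$. Then \[ \sup\bigl\{\#\{\langle H\cap B_{2^k}\rangle : k\in\mathbb Z\} : H \text{ a discrete subgroup of } G\bigr\}<\infty, \] where $\langle A\rangle$ denotes the subgroup of $G$ generated by $A$. -/

import Mathlib

open scoped Manifold ContDiff

/-- A smooth real Lie group is in particular smooth to the order needed for Mathlib's Lie algebra
structure on the tangent space at the identity. -/
instance lieGroup_minSmoothness_three {E : Type*} [NormedAddCommGroup E] [NormedSpace ℝ E]
    {G : Type*} [TopologicalSpace G] [ChartedSpace E G] [Group G] [h : LieGroup 𝓘(ℝ, E) ∞ G] :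
    LieGroup 𝓘(ℝ, E) (minSmoothness ℝ 3) G := by
  have h3 : minSmoothness ℝ 3 = 3 := minSmoothness_of_isRCLikeNormedField
  rw [h3]
  infer_instance

/-- A stratification `L = V 1 ⊕ V 2 ⊕ ⋯ ⊕ V step` of a real Lie algebra `L`: a direct sum
decomposition into non-trivial linear subspaces with `[V 1, V i] = V (i + 1)` for `1 ≤ i < step`
and `[V 1, V step] = 0`. The family is indexed by `ℕ`, with `V i = 0` outside `1 ≤ i ≤ step`.
As usual, `[V 1, V i]` is the linear span of the brackets. -/
structure LieStratification (L : Type*) [LieRing L] [LieAlgebra ℝ L] where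
  /-- The number of layers. -/
  step : ℕ
  /-- The layers. -/
  V : ℕ → Submodule ℝ L
  eq_bot : ∀ i, i < 1 ∨ step < i → V i = ⊥
  ne_bot : ∀ i, 1 ≤ i → i ≤ step → V i ≠ ⊥
  isInternal : DirectSum.IsInternal V
  bracket_eq : ∀ i, 1 ≤ i → i < step →
    Submodule.span ℝ {Z | ∃ X ∈ V 1, ∃ Y ∈ V i, ⁅X, Y⁆ = Z} = V (i + 1)
  bracket_last : ∀ X ∈ V 1, ∀ Y ∈ V step, ⁅X, Y⁆ = 0

namespace LieStratification

variable {L : Type*} [LieRing L] [LieAlgebra ℝ L]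

/-- The projection of `X = X₁ + ⋯ + X_s` to its component `Xᵢ` in the layer `V i`. -/
noncomputable def component (S : LieStratification L) (i : ℕ) (X : L) : L :=
  letI := S.isInternal.chooseDecomposition
  (DirectSum.decompose S.V X i : L)

/-- The dilation `δ_t (X₁ + X₂ + ⋯ + X_s) = t X₁ + t² X₂ + ⋯ + t^s X_s` of the Lie algebra. -/
noncomputable def dilation (S : LieStratification L) (t : ℝ) (X : L) : L :=
  ∑ i ∈ Finset.Icc 1 S.step, t ^ i • S.component i X

end LieStratification

section LieGroups

variable {E : Type*} [NormedAddCommGroup E] [NormedSpace ℝ E]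
  {G : Type*} [TopologicalSpace G] [ChartedSpace E G] [Group G]

/-- The exponential map of a Lie group: `lieExp X` is the value at time `1` of the integral curve
through `1`, defined for all times, of the left-invariant vector field with value `X` at `1`.
(In a finite-dimensional Hausdorff Lie group there is exactly one such curve.) -/
noncomputable def lieExp (X : GroupLieAlgebra 𝓘(ℝ, E) G) : G :=
  (Classical.epsilon fun γ : ℝ → G =>
    γ 0 = 1 ∧ IsMIntegralCurve (I := 𝓘(ℝ, E)) γ (mulInvariantVectorField X)) 1

/-- `d` is a left-invariant homogeneous metric on the Carnot group `G` with stratification `S`: a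
metric on the set `G` such that `d (z x) (z y) = d x y` and `d (D_t x) (D_t y) = t * d x y` for all
`t > 0`. Here `D_t = exp ∘ δ_t ∘ log`, that is, `D_t (exp X) = exp (δ_t X)`; as the exponential map
of a simply connected nilpotent Lie group is a bijection, points are written as `exp X`. -/
structure IsHomogeneousMetric [CompleteSpace E] [LieGroup 𝓘(ℝ, E) ∞ G]
    (S : LieStratification (GroupLieAlgebra 𝓘(ℝ, E) G)) (d : G → G → ℝ) : Prop where
  eq_zero_iff : ∀ x y, d x y = 0 ↔ x = y
  symm : ∀ x y, d x y = d y x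
  triangle : ∀ x y z, d x z ≤ d x y + d y z
  left_invariant : ∀ x y z, d (z * x) (z * y) = d x y
  homogeneous : ∀ t : ℝ, 0 < t → ∀ X Y : GroupLieAlgebra 𝓘(ℝ, E) G,
    d (lieExp (S.dilation t X)) (lieExp (S.dilation t Y)) = t * d (lieExp X) (lieExp Y)

end LieGroups

open scoped Topology

/-!
For a subgroup `H` of the Carnot group `G` put `N x = d 1 x`, `A k = H ∩ {N ≤ 2 ^ k}`, and let `n
k` be the Lie subalgebra generated by the logarithms of the elements of `A k`. The theorem rests
on the covering estimate `exists_covering_constant`: every element of `exp (n k)` lies within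
distance `K * 2 ^ k` of the subgroup `⟨A k⟩`, with `K` independent of `H` and `k`. Hence, for a
fixed `c`, `n j ≤ n k` implies `⟨A j⟩ ≤ ⟨A (k + c)⟩` (`exists_closure_inter_le`). The `n k`
increase with `k`, so at most `dim G + 1` different ones occur, and on a range of `k` where `n k`
is constant the group `⟨A k⟩` changes only in the first `c` steps. This bounds the number of
groups `⟨A k⟩` by a constant that does not depend on `H`.

For the covering estimate let `n` be generated by the logarithms of `A`, where `N ≤ r` on `A`. The
group commutator of two exponentials is the exponential of the Lie bracket up to brackets of higher
order, so iterated commutators of elements of `A` show that, modulo the next term, the `i`-th term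
`C i` of the lower central series of `n` is spanned by vectors `Y` with `exp Y ∈ ⟨A⟩` and
`N (exp Y) ≤ 4 ^ i * r` (`lowerCentralSubmodule_le_span_sup`). An element `exp (∑ tⱼ Yⱼ + Z)` with
`Z ∈ C (i + 1)` is then treated by splitting each `tⱼ` into integral and fractional part: the
integral parts produce an element of `⟨A⟩` on the left, the fractional parts a bounded factor on the
right, and an element of `exp (C (i + 1))` remains in between. The bound for the fractional parts is
`exists_exp_smul_le`: `N (exp (t X)) ≤ C * N (exp X)` for `t ∈ [0, 1]`. It follows from homogeneity
and compactness once `X ↦ N (exp X)` is known to be continuous and positive away from `0`.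

Mathlib has neither the Baker–Campbell–Hausdorff formula nor the surjectivity of the exponential map
of a nilpotent Lie group. What is needed of them is derived from the differential equation satisfied
by products of curves, `(g h)' = g h (Ad h⁻¹ ξ + η)` for `g' = g ξ` and `h' = h η`: a curve whose
logarithmic derivative stays in a nilpotent subalgebra is a product of one-parameter subgroups of
that subalgebra, obtained by splitting off one coordinate of the logarithmic derivative at a time
(`exists_logDeriv_reduction`). The part of the argument after the differential calculus uses only
the properties of `exp` and `Ad` collected in the structure `ExpCalculus`.
-/

/-! ### Logarithmic derivatives of curves in a Lie group -/

section LieCalculus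

variable {E : Type*} [NormedAddCommGroup E] [NormedSpace ℝ E]
  {G : Type*} [TopologicalSpace G] [ChartedSpace E G]

/-- The derivative at `x` of a self-map of a manifold modelled on `E`, as an endomorphism of `E`:
all tangent spaces are identified with `E` through their definition. -/
noncomputable def mD (f : G → G) (x : G) : E →L[ℝ] E := mfderiv 𝓘(ℝ, E) 𝓘(ℝ, E) f x

/-- The curve `g` has manifold derivative `A` at time `t`, the tangent space being read as `E`. -/
def HasCurveDeriv (g : ℝ → G) (A : ℝ →L[ℝ] E) (t : ℝ) : Prop :=
  HasMFDerivAt 𝓘(ℝ, ℝ) 𝓘(ℝ, E) g t A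

/-- The curve `g` is differentiable at time `t` with velocity `v`. -/
def HasVelocity (g : ℝ → G) (v : E) (t : ℝ) : Prop :=
  HasCurveDeriv g ((1 : ℝ →L[ℝ] ℝ).smulRight v) t

theorem HasCurveDeriv.hasVelocity {g : ℝ → G} {A : ℝ →L[ℝ] E} {t : ℝ} {v : E}
    (h : HasCurveDeriv g A t) (hv : A 1 = v) : HasVelocity g v t := by
  have e : A = (1 : ℝ →L[ℝ] ℝ).smulRight v := by ext; simp [hv]
  rwa [e] at h

theorem mD_comp {f g : G → G} {x : G} (hf : MDifferentiableAt 𝓘(ℝ, E) 𝓘(ℝ, E) f (g x))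
    (hg : MDifferentiableAt 𝓘(ℝ, E) 𝓘(ℝ, E) g x) (v : E) :
    mD (fun y => f (g y)) x v = mD f (g x) (mD g x v) := by
  have := mfderiv_comp x hf hg
  exact congrArg (fun A : E →L[ℝ] E => A v) this

theorem mD_id (x : G) (v : E) : mD (fun y : G => y) x v = v := by
  have := mfderiv_id (I := 𝓘(ℝ, E)) (x := x)
  exact congrArg (fun A : E →L[ℝ] E => A v) this

theorem HasVelocity.comp {g : ℝ → G} {v : E} {t : ℝ} (hg : HasVelocity g v t) {f : G → G}
    (hf : MDifferentiableAt 𝓘(ℝ, E) 𝓘(ℝ, E) f (g t)) :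
    HasVelocity (fun s => f (g s)) (mD f (g t) v) t := by
  have h := hf.hasMFDerivAt.comp t hg
  exact HasCurveDeriv.hasVelocity (A := (mD f (g t)).comp ((1 : ℝ →L[ℝ] ℝ).smulRight v)) h (by simp)

theorem HasVelocity.comp_real {g : ℝ → G} {v : E} {t : ℝ} {c : ℝ → ℝ} {c' : ℝ}
    (hg : HasVelocity g v (c t)) (hc : HasDerivAt c c' t) :
    HasVelocity (fun s => g (c s)) (c' • v) t := by
  have hc' : HasMFDerivAt 𝓘(ℝ, ℝ) 𝓘(ℝ, ℝ) c t ((1 : ℝ →L[ℝ] ℝ).smulRight c') :=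
    hc.hasFDerivAt.hasMFDerivAt
  exact HasCurveDeriv.hasVelocity
    (A := ((1 : ℝ →L[ℝ] ℝ).smulRight v).comp ((1 : ℝ →L[ℝ] ℝ).smulRight c'))
    (HasMFDerivAt.comp t hg hc') (by simp)

theorem hasVelocity_const (x : G) (t : ℝ) : HasVelocity (fun _ => x) (0 : E) t :=
  HasCurveDeriv.hasVelocity (hasMFDerivAt_const (I := 𝓘(ℝ, ℝ)) (I' := 𝓘(ℝ, E)) x t) rfl

variable [Group G]

/-- The curve `g`, defined for all times, has logarithmic derivative `ξ`: it satisfies `g' = g ξ`,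
where `g ξ` is the image of `ξ ∈ E = T₁G` under left translation. -/
def HasLogDeriv (g : ℝ → G) (ξ : ℝ → E) : Prop :=
  ∀ t, HasVelocity g (mD (fun y => g t * y) 1 (ξ t)) t

/-- The adjoint representation: the derivative at `1` of conjugation by `g`. -/
noncomputable def lieAd (g : G) : E →L[ℝ] E := mD (fun x : G => g * x * g⁻¹) 1

theorem lieAd_one (X : E) : lieAd (1 : G) X = X := by
  unfold lieAd
  simp [mD_id]

variable [LieGroup 𝓘(ℝ, E) ∞ G]

theorem mdifferentiableAt_mul_left' (a x : G) :
    MDifferentiableAt 𝓘(ℝ, E) 𝓘(ℝ, E) (fun y : G => a * y) x :=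
  (contMDiff_mul_left (I := 𝓘(ℝ, E)) (n := ∞) (a := a)).mdifferentiableAt (by simp)

theorem mdifferentiableAt_mul_right' (a x : G) :
    MDifferentiableAt 𝓘(ℝ, E) 𝓘(ℝ, E) (fun y : G => y * a) x :=
  (contMDiff_mul_right (I := 𝓘(ℝ, E)) (n := ∞) (a := a)).mdifferentiableAt (by simp)

theorem mdifferentiableAt_conj (a x : G) :
    MDifferentiableAt 𝓘(ℝ, E) 𝓘(ℝ, E) (fun y : G => a * y * a⁻¹) x :=
  (mdifferentiableAt_mul_right' a⁻¹ (a * x)).comp x (mdifferentiableAt_mul_left' a x)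

theorem mD_mul_left_mul (a g : G) (X : E) :
    mD (fun y : G => a * y) g (mD (fun y : G => g * y) 1 X) = mD (fun y : G => a * g * y) 1 X := by
  have h : (fun y : G => a * g * y) = fun y => a * (g * y) := by
    ext y; simp [mul_assoc]
  rw [h, mD_comp (f := fun y => a * y) (g := fun y => g * y)
    (mdifferentiableAt_mul_left' a _) (mdifferentiableAt_mul_left' g _)]
  simp

theorem lieAd_mul (g h : G) (X : E) : lieAd (g * h) X = lieAd g (lieAd h X) := by
  unfold lieAd
  have e : (fun x : G => g * h * x * (g * h)⁻¹) = fun x => g * (h * x * h⁻¹) * g⁻¹ := by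
    ext x; simp [mul_assoc]
  rw [e, mD_comp (f := fun x => g * x * g⁻¹) (g := fun x => h * x * h⁻¹)
    (mdifferentiableAt_conj _ _) (mdifferentiableAt_conj _ _)]
  simp

theorem mD_mul_right_eq (g h : G) (X : E) :
    mD (fun y : G => y * h) g (mD (fun y : G => g * y) 1 X) =
      mD (fun y : G => g * h * y) 1 (lieAd h⁻¹ X) := by
  have h1 := mD_comp (f := fun y : G => g * h * y) (g := fun x => h⁻¹ * x * h⁻¹⁻¹) (x := 1)
    (mdifferentiableAt_mul_left' _ _) (mdifferentiableAt_conj h⁻¹ 1) X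
  have h2 := mD_comp (f := fun y : G => y * h) (g := fun x => g * x) (x := 1)
    (mdifferentiableAt_mul_right' _ _) (mdifferentiableAt_mul_left' g 1) X
  have e : (fun y : G => g * h * (h⁻¹ * y * h⁻¹⁻¹)) = fun y => g * y * h := by
    ext x; simp [mul_assoc]
  have e2 : h⁻¹ * 1 * h⁻¹⁻¹ = 1 := by simp
  rw [e, h2, e2, mul_one] at h1
  exact h1

theorem HasVelocity.mul {g h : ℝ → G} {v w : E} {t : ℝ} (hg : HasVelocity g v t)
    (hh : HasVelocity h w t) :
    HasVelocity (fun s => g s * h s)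
      (mD (fun y => y * h t) (g t) v + mD (fun y => g t * y) (h t) w) t := by
  have h2 : MDifferentiableAt (𝓘(ℝ, E).prod 𝓘(ℝ, E)) 𝓘(ℝ, E) (fun p : G × G => p.1 * p.2)
    (g t, h t) := (contMDiff_mul 𝓘(ℝ, E) ∞).mdifferentiableAt (by simp)
  have h3 := h2.hasMFDerivAt.comp t (HasMFDerivAt.prodMk hg hh)
  refine HasCurveDeriv.hasVelocity h3 ?_
  have e : (((1 : ℝ →L[ℝ] ℝ).smulRight v).prod ((1 : ℝ →L[ℝ] ℝ).smulRight w)) 1 = (v, w) := by simp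
  exact (congrArg (fun z : E × E => (mfderiv (𝓘(ℝ, E).prod 𝓘(ℝ, E)) 𝓘(ℝ, E)
    (fun p : G × G => p.1 * p.2) (g t, h t) : E × E →L[ℝ] E) z) e).trans
    (mfderiv_prod_eq_add_apply (v := (v, w)) h2)

theorem HasLogDeriv.mul {g h : ℝ → G} {ξ η : ℝ → E} (hg : HasLogDeriv g ξ)
    (hh : HasLogDeriv h η) :
    HasLogDeriv (fun t => g t * h t) (fun t => lieAd (h t)⁻¹ (ξ t) + η t) := by
  intro t
  have := (hg t).mul (hh t)
  rwa [mD_mul_right_eq, mD_mul_left_mul, ← map_add] at this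

omit [LieGroup 𝓘(ℝ, E) ∞ G] in
theorem hasLogDeriv_const (x : G) : HasLogDeriv (fun _ => x) (fun _ => (0 : E)) := by
  intro t
  simpa using hasVelocity_const (E := E) x t

theorem HasLogDeriv.conj {g : ℝ → G} {ξ : ℝ → E} (hg : HasLogDeriv g ξ) (a : G) :
    HasLogDeriv (fun t => a * g t * a⁻¹) (fun t => lieAd a (ξ t)) := by
  simpa using ((hasLogDeriv_const a).mul hg).mul (hasLogDeriv_const (E := E) a⁻¹)

omit [LieGroup 𝓘(ℝ, E) ∞ G] in
theorem HasLogDeriv.comp_real {g : ℝ → G} {ξ : ℝ → E} (hg : HasLogDeriv g ξ) {c c' : ℝ → ℝ}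
    (hc : ∀ t, HasDerivAt c (c' t) t) :
    HasLogDeriv (fun t => g (c t)) (fun t => c' t • ξ (c t)) := by
  intro t
  simpa using (hg (c t)).comp_real (hc t)

theorem contMDiff_one_mulInvariantVectorField (X : GroupLieAlgebra 𝓘(ℝ, E) G) :
    ContMDiff 𝓘(ℝ, E) 𝓘(ℝ, E).tangent 1
      (fun g : G => (⟨g, mulInvariantVectorField X g⟩ : TangentBundle 𝓘(ℝ, E) G)) :=
  (contMDiff_mulInvariantVectorField X).of_le
    (le_trans (by exact_mod_cast one_le_two) le_minSmoothness)

instance isManifold_one_of_lieGroup : IsManifold 𝓘(ℝ, E) 1 G := by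
  have : IsManifold 𝓘(ℝ, E) ∞ G := LieGroup.toContMDiffMul.toIsManifold
  exact IsManifold.of_le (n := ∞) (by exact_mod_cast le_top)

variable [T2Space G] [CompleteSpace E]

omit [CompleteSpace E] in
theorem HasLogDeriv.eq_of_const {g h : ℝ → G} {X : E} (hg : HasLogDeriv g fun _ => X)
    (hh : HasLogDeriv h fun _ => X) (h0 : g 0 = h 0) : g = h :=
  isMIntegralCurve_eq_of_contMDiff (t₀ := 0) (fun _ => BoundarylessManifold.isInteriorPoint)
    (contMDiff_one_mulInvariantVectorField X) hg hh h0

/-- Left-invariant vector fields are complete: a local integral curve through `1` and its left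
translates give integral curves through all points on a time interval of fixed length. -/
theorem exists_hasLogDeriv_const (X : E) :
    ∃ g : ℝ → G, g 0 = 1 ∧ HasLogDeriv g fun _ => X := by
  obtain ⟨γ, h0, hγ⟩ := exists_isMIntegralCurveAt_of_contMDiffAt_boundaryless (I := 𝓘(ℝ, E)) 0
    (contMDiff_one_mulInvariantVectorField (G := G) X 1)
  obtain ⟨ε, hε, hγ⟩ := isMIntegralCurveAt_iff'.1 hγ
  rw [Real.ball_eq_Ioo, zero_sub, zero_add] at hγ
  refine exists_isMIntegralCurve_of_isMIntegralCurveOn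
    (contMDiff_one_mulInvariantVectorField (G := G) X) hε
    (fun x => ⟨fun t => x * γ t, by simp [h0], ?_⟩) 1
  intro t ht
  have h1 : HasVelocity γ (mD (fun y => γ t * y) 1 X) t :=
    (hγ t ht).hasMFDerivAt (Ioo_mem_nhds ht.1 ht.2)
  have h2 := h1.comp (mdifferentiableAt_mul_left' x (γ t))
  rw [mD_mul_left_mul] at h2
  exact HasMFDerivAt.hasMFDerivWithinAt h2

variable (G) in
/-- The exponential map `lieExp` with the Lie algebra read as the model space `E`. -/
noncomputable def modelExp (X : E) : G := lieExp (E := E) (G := G) X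

theorem modelExp_spec (X : E) : ∃ g : ℝ → G, g 0 = 1 ∧ HasLogDeriv g (fun _ => X) ∧
    g 1 = modelExp G X := by
  have h := Classical.epsilon_spec (exists_hasLogDeriv_const (G := G) X)
  exact ⟨_, h.1, h.2, rfl⟩

theorem HasLogDeriv.eq_modelExp {g : ℝ → G} {X : E} (hg : HasLogDeriv g fun _ => X) (h0 : g 0 = 1)
    (t : ℝ) : g t = modelExp G (t • X) := by
  obtain ⟨γ, hγ0, hγ, hγ1⟩ := modelExp_spec (G := G) (t • X)
  have h := hg.comp_real (c := fun s => s * t) (c' := fun _ => t)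
    (fun s => by simpa using (hasDerivAt_id s).mul_const t)
  rw [← hγ1, ← h.eq_of_const hγ (by simp [h0, hγ0])]
  simp

theorem hasLogDeriv_modelExp (X : E) :
    HasLogDeriv (fun t : ℝ => modelExp G (t • X)) fun _ => X := by
  obtain ⟨γ, hγ0, hγ, -⟩ := modelExp_spec (G := G) X
  have : γ = fun t : ℝ => modelExp G (t • X) := funext fun t => hγ.eq_modelExp hγ0 t
  exact this ▸ hγ

theorem modelExp_zero : modelExp G (0 : E) = 1 := by
  have := (hasLogDeriv_const (E := E) (1 : G)).eq_modelExp rfl 1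
  simpa using this.symm

theorem modelExp_add_smul (s t : ℝ) (X : E) :
    modelExp G ((s + t) • X) = modelExp G (s • X) * modelExp G (t • X) := by
  have h1 := (hasLogDeriv_modelExp (G := G) X).comp_real (c := fun t => s + t) (c' := fun _ => 1)
    (fun t => (hasDerivAt_id t).const_add s)
  have h2 := (hasLogDeriv_const (modelExp G (s • X))).mul
    (hasLogDeriv_modelExp (G := G) X)
  simp only [map_zero, zero_add, one_smul] at h1 h2
  exact congrFun (h1.eq_of_const h2 (by simp [modelExp_zero])) t

theorem modelExp_lieAd (a : G) (X : E) :
    modelExp G (lieAd a X) = a * modelExp G X * a⁻¹ := by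
  have h := ((hasLogDeriv_modelExp (G := G) X).conj a).eq_modelExp (by simp [modelExp_zero]) 1
  simpa using h.symm

omit [CompleteSpace E] in
theorem HasLogDeriv.eq_const {g : ℝ → G} (hg : HasLogDeriv g fun _ => (0 : E)) (t : ℝ) :
    g t = g 0 :=
  congrFun (hg.eq_of_const (hasLogDeriv_const (E := E) (g 0)) rfl) t

theorem eq_zero_of_modelExp_smul_eq_one {X : E} (h : ∀ t : ℝ, modelExp G (t • X) = 1) : X = 0 := by
  have h1 := hasLogDeriv_modelExp (G := G) X 0
  have h2 := hasVelocity_const (E := E) (1 : G) 0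
  simp only [h] at h1
  have h3 := hasMFDerivAt_unique h1 h2
  have h4 := congrArg (fun A : ℝ →L[ℝ] E => A 1) h3
  simpa [mD_id] using h4

end LieCalculus

/-! ### The Lie bracket in the chart at the identity -/

section ChartCalculus

variable {E : Type*} [NormedAddCommGroup E] [NormedSpace ℝ E]
  {G : Type*} [TopologicalSpace G] [ChartedSpace E G]

/-- The derivative at `x` of a map from a manifold to `E`, as an endomorphism of `E`. -/
noncomputable def mDE (f : G → E) (x : G) : E →L[ℝ] E := mfderiv 𝓘(ℝ, E) 𝓘(ℝ, E) f x

theorem mDE_comp {f : G → E} {g : G → G} {x : G}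
    (hf : MDifferentiableAt 𝓘(ℝ, E) 𝓘(ℝ, E) f (g x))
    (hg : MDifferentiableAt 𝓘(ℝ, E) 𝓘(ℝ, E) g x) (v : E) :
    mDE (fun y => f (g y)) x v = mDE f (g x) (mD g x v) := by
  have := mfderiv_comp x hf hg
  exact congrArg (fun A : E →L[ℝ] E => A v) this

variable [Group G]

variable (E G) in
/-- The preferred chart at the identity. -/
noncomputable def chartOne : G → E := extChartAt 𝓘(ℝ, E) (1 : G)

variable (E G) in
/-- The inverse of the preferred chart at the identity. -/
noncomputable def chartOneSymm : E → G := (extChartAt 𝓘(ℝ, E) (1 : G)).symm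

theorem chartOneSymm_chartOne_one : chartOneSymm E G (chartOne E G 1) = 1 :=
  extChartAt_to_inv (I := 𝓘(ℝ, E)) (1 : G)

theorem mDE_one_eq_fderiv {f : G → E} (hf : MDifferentiableAt 𝓘(ℝ, E) 𝓘(ℝ, E) f 1) :
    mDE f 1 = fderiv ℝ (fun v => f (chartOneSymm E G v)) (chartOne E G 1) := by
  have h := hf.mfderiv
  rw [ModelWithCorners.range_eq_univ, fderivWithin_univ] at h
  exact h

theorem mD_one_eq_fderiv {f : G → G} (hf : MDifferentiableAt 𝓘(ℝ, E) 𝓘(ℝ, E) f 1) (h1 : f 1 = 1) :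
    mD f 1 = fderiv ℝ (fun v => chartOne E G (f (chartOneSymm E G v))) (chartOne E G 1) := by
  have h := hf.mfderiv
  rw [ModelWithCorners.range_eq_univ, fderivWithin_univ] at h
  refine Eq.trans h ?_
  unfold writtenInExtChartAt
  rw [h1]
  rfl

variable [LieGroup 𝓘(ℝ, E) ∞ G]

theorem contMDiffAt_chartOneSymm :
    ContMDiffAt 𝓘(ℝ, E) 𝓘(ℝ, E) ∞ (chartOneSymm E G) (chartOne E G 1) := by
  have : IsManifold 𝓘(ℝ, E) ∞ G := LieGroup.toContMDiffMul.toIsManifold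
  exact (contMDiffOn_extChartAt_symm (I := 𝓘(ℝ, E)) (n := ∞) (1 : G)).contMDiffAt
    (extChartAt_target_mem_nhds (I := 𝓘(ℝ, E)) (1 : G))

omit [LieGroup 𝓘(ℝ, E) ∞ G] in
theorem contMDiffAt_chartOne : ContMDiffAt 𝓘(ℝ, E) 𝓘(ℝ, E) ∞ (chartOne E G) 1 :=
  contMDiffAt_extChartAt

omit [LieGroup 𝓘(ℝ, E) ∞ G] in
theorem contDiffAt_chartOne_comp {F : E × E → G} {p : E × E}
    (hF : ContMDiffAt 𝓘(ℝ, E × E) 𝓘(ℝ, E) ∞ F p) (h1 : F p = 1) :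
    ContDiffAt ℝ ∞ (fun p => chartOne E G (F p)) p := by
  rw [← contMDiffAt_iff_contDiffAt]
  have h2 : ContMDiffAt 𝓘(ℝ, E) 𝓘(ℝ, E) ∞ (chartOne E G) (F p) := by
    rw [h1]; exact contMDiffAt_chartOne
  exact ContMDiffAt.comp p h2 hF

theorem contMDiffAt_chartOneSymm_fst :
    ContMDiffAt 𝓘(ℝ, E × E) 𝓘(ℝ, E) ∞ (fun p : E × E => chartOneSymm E G p.1)
      (chartOne E G 1, chartOne E G 1) :=
  ContMDiffAt.comp (chartOne E G 1, chartOne E G 1) (I' := 𝓘(ℝ, E)) (g := chartOneSymm E G)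
    (f := Prod.fst) contMDiffAt_chartOneSymm contDiff_fst.contMDiff.contMDiffAt

theorem contMDiffAt_chartOneSymm_snd :
    ContMDiffAt 𝓘(ℝ, E × E) 𝓘(ℝ, E) ∞ (fun p : E × E => chartOneSymm E G p.2)
      (chartOne E G 1, chartOne E G 1) :=
  ContMDiffAt.comp (chartOne E G 1, chartOne E G 1) (I' := 𝓘(ℝ, E)) (g := chartOneSymm E G)
    (f := Prod.snd) contMDiffAt_chartOneSymm contDiff_snd.contMDiff.contMDiffAt

variable (E G) in
/-- The multiplication `(x, y) ↦ x * y` in the chart at the identity. -/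
noncomputable def chartMul (p : E × E) : E :=
  chartOne E G (chartOneSymm E G p.1 * chartOneSymm E G p.2)

variable (E G) in
/-- The conjugation `(x, y) ↦ x * y * x⁻¹` in the chart at the identity. -/
noncomputable def chartConj (p : E × E) : E :=
  chartOne E G (chartOneSymm E G p.1 * chartOneSymm E G p.2 * (chartOneSymm E G p.1)⁻¹)

variable (E G) in
/-- The map `(x, y) ↦ x⁻¹ * y` in the chart at the identity. -/
noncomputable def chartDiv (p : E × E) : E :=
  chartOne E G ((chartOneSymm E G p.1)⁻¹ * chartOneSymm E G p.2)

theorem contDiffAt_chartMul : ContDiffAt ℝ ∞ (chartMul E G) (chartOne E G 1, chartOne E G 1) :=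
  contDiffAt_chartOne_comp (contMDiffAt_chartOneSymm_fst.mul contMDiffAt_chartOneSymm_snd)
    (by simp [chartOneSymm_chartOne_one])

theorem contDiffAt_chartConj : ContDiffAt ℝ ∞ (chartConj E G) (chartOne E G 1, chartOne E G 1) :=
  contDiffAt_chartOne_comp ((contMDiffAt_chartOneSymm_fst.mul contMDiffAt_chartOneSymm_snd).mul
    contMDiffAt_chartOneSymm_fst.inv)
    (by simp [chartOneSymm_chartOne_one])

theorem contDiffAt_chartDiv : ContDiffAt ℝ ∞ (chartDiv E G) (chartOne E G 1, chartOne E G 1) :=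
  contDiffAt_chartOne_comp (contMDiffAt_chartOneSymm_fst.inv.mul contMDiffAt_chartOneSymm_snd)
    (by simp [chartOneSymm_chartOne_one])

omit [LieGroup 𝓘(ℝ, E) ∞ G] in
theorem eventually_chartOneSymm_chartOne :
    ∀ᶠ g in 𝓝 (1 : G), chartOneSymm E G (chartOne E G g) = g := by
  filter_upwards [extChartAt_source_mem_nhds (I := 𝓘(ℝ, E)) (1 : G)] with g hg
  exact (extChartAt 𝓘(ℝ, E) (1 : G)).left_inv hg

omit [LieGroup 𝓘(ℝ, E) ∞ G] in
theorem eventually_chartOne_chartOneSymm :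
    ∀ᶠ u in 𝓝 (chartOne E G 1), chartOne E G (chartOneSymm E G u) = u := by
  filter_upwards [extChartAt_target_mem_nhds (I := 𝓘(ℝ, E)) (1 : G)] with g hg
  exact (extChartAt 𝓘(ℝ, E) (1 : G)).right_inv hg

/-- The identity `(x y x⁻¹) x = x y`, read in the chart. -/
theorem eventually_chartMul_chartConj :
    ∀ᶠ p in 𝓝 (chartOne E G 1, chartOne E G 1),
      chartMul E G (chartConj E G p, p.1) = chartMul E G p := by
  have hc : Filter.Tendsto (fun p : E × E =>
      chartOneSymm E G p.1 * chartOneSymm E G p.2 * (chartOneSymm E G p.1)⁻¹)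
      (𝓝 (chartOne E G 1, chartOne E G 1)) (𝓝 1) := by
    have := (((contMDiffAt_chartOneSymm_fst (E := E) (G := G)).mul
      contMDiffAt_chartOneSymm_snd).mul contMDiffAt_chartOneSymm_fst.inv).continuousAt
    simpa [ContinuousAt, chartOneSymm_chartOne_one] using! this
  filter_upwards [hc.eventually (eventually_chartOneSymm_chartOne (E := E))] with p hp
  simp [chartMul, chartConj, hp]

variable (G) in
/-- The left-invariant vector field with value `X` at the identity, read in the chart. -/
noncomputable def chartField (X : E) : E → E :=
  VectorField.mpullbackWithin 𝓘(ℝ, E) 𝓘(ℝ, E) (extChartAt 𝓘(ℝ, E) (1 : G)).symm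
      (mulInvariantVectorField (G := G) X) (Set.range 𝓘(ℝ, E))

theorem chartField_eq_fderiv_chartMul {u : E} {X : E}
    (hu : u ∈ (extChartAt 𝓘(ℝ, E) (1 : G)).target) :
    chartField G X u = fderiv ℝ (fun v => chartMul E G (u, v)) (chartOne E G 1) X := by
  have hs : chartOneSymm E G u ∈ (chartAt E (1 : G)).source := by
    rw [← extChartAt_source 𝓘(ℝ, E)]
    exact (extChartAt 𝓘(ℝ, E) (1 : G)).map_target hu
  have hφ : MDifferentiableAt 𝓘(ℝ, E) 𝓘(ℝ, E) (chartOne E G) (chartOneSymm E G u * 1) := by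
    rw [mul_one]
    exact mdifferentiableAt_extChartAt hs
  have h1 := mDE_comp hφ (mdifferentiableAt_mul_left' (chartOneSymm E G u) 1) X
  rw [mDE_one_eq_fderiv (f := fun y => chartOne E G (chartOneSymm E G u * y))
    (MDifferentiableAt.comp 1 hφ (mdifferentiableAt_mul_left' (chartOneSymm E G u) 1)),
    mul_one] at h1
  refine Eq.trans ?_ h1.symm
  have h2 := ContinuousLinearMap.inverse_eq
    (mfderivWithin_extChartAt_symm_comp_mfderiv_extChartAt (I := 𝓘(ℝ, E)) hu)
    (mfderiv_extChartAt_comp_mfderivWithin_extChartAt_symm (I := 𝓘(ℝ, E)) hu)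
  exact congrArg (fun A : E →L[ℝ] E => A (mD (fun y => chartOneSymm E G u * y) 1 X)) h2

theorem eventually_differentiableAt_chartMul : ∀ᶠ p in 𝓝 (chartOne E G 1, chartOne E G 1),
    DifferentiableAt ℝ (chartMul E G) p :=
  ((contDiffAt_chartMul (E := E) (G := G)).of_le (m := 1) (by simp)).eventually (by simp) |>.mono
    fun _ h => h.differentiableAt (by simp)

theorem eventually_differentiableAt_chartConj : ∀ᶠ p in 𝓝 (chartOne E G 1, chartOne E G 1),
    DifferentiableAt ℝ (chartConj E G) p :=
  ((contDiffAt_chartConj (E := E) (G := G)).of_le (m := 1) (by simp)).eventually (by simp) |>.mono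
    fun _ h => h.differentiableAt (by simp)

omit [Group G] [LieGroup 𝓘(ℝ, E) ∞ G] in
theorem fderiv_comp_prodMk_right {F : Type*} [NormedAddCommGroup F] [NormedSpace ℝ F]
    {f : E × E → F} {u v : E} (hf : DifferentiableAt ℝ f (u, v)) (X : E) :
    fderiv ℝ (fun w => f (u, w)) v X = fderiv ℝ f (u, v) (0, X) := by
  have h := HasFDerivAt.comp v (g := f) (f := fun w => (u, w)) hf.hasFDerivAt
    ((hasFDerivAt_const u v).prodMk (hasFDerivAt_id v))
  exact (congrArg (fun B : E →L[ℝ] F => B X) h.fderiv).trans (by simp)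

omit [Group G] [LieGroup 𝓘(ℝ, E) ∞ G] in
theorem fderiv_comp_prodMk_left {F : Type*} [NormedAddCommGroup F] [NormedSpace ℝ F]
    {f : E × E → F} {u v : E} (hf : DifferentiableAt ℝ f (u, v)) (X : E) :
    fderiv ℝ (fun w => f (w, v)) u X = fderiv ℝ f (u, v) (X, 0) := by
  have h := HasFDerivAt.comp u (g := f) (f := fun w => (w, v)) hf.hasFDerivAt
    ((hasFDerivAt_id u).prodMk (hasFDerivAt_const v u))
  exact (congrArg (fun B : E →L[ℝ] F => B X) h.fderiv).trans (by simp)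

theorem differentiableAt_fderiv_chartMul : DifferentiableAt ℝ (fderiv ℝ (chartMul E G))
    (chartOne E G 1, chartOne E G 1) :=
  ((contDiffAt_chartMul (E := E) (G := G)).fderiv_right (m := 1) (by norm_cast)).differentiableAt
    (by simp)

theorem differentiableAt_fderiv_chartConj : DifferentiableAt ℝ (fderiv ℝ (chartConj E G))
    (chartOne E G 1, chartOne E G 1) :=
  ((contDiffAt_chartConj (E := E) (G := G)).fderiv_right (m := 1) (by norm_cast)).differentiableAt
    (by simp)

theorem fderiv_chartMul_zero_left (X : E) :
    fderiv ℝ (chartMul E G) (chartOne E G 1, chartOne E G 1) (0, X) = X := by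
  rw [← fderiv_comp_prodMk_right
    (eventually_differentiableAt_chartMul (E := E) (G := G)).self_of_nhds]
  have : (fun w => chartMul E G (chartOne E G 1, w)) =ᶠ[𝓝 (chartOne E G 1)] id := by
    filter_upwards [eventually_chartOne_chartOneSymm (E := E) (G := G)] with u hu
    simp [chartMul, chartOneSymm_chartOne_one, hu]
  rw [this.fderiv_eq]; simp

theorem fderiv_chartMul_zero_right (X : E) :
    fderiv ℝ (chartMul E G) (chartOne E G 1, chartOne E G 1) (X, 0) = X := by
  rw [← fderiv_comp_prodMk_left
    (eventually_differentiableAt_chartMul (E := E) (G := G)).self_of_nhds]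
  have : (fun w => chartMul E G (w, chartOne E G 1)) =ᶠ[𝓝 (chartOne E G 1)] id := by
    filter_upwards [eventually_chartOne_chartOneSymm (E := E) (G := G)] with u hu
    simp [chartMul, chartOneSymm_chartOne_one, hu]
  rw [this.fderiv_eq]; simp

omit [NormedSpace ℝ E] [Group G] [LieGroup 𝓘(ℝ, E) ∞ G] in
theorem eventually_prodMk_const {e : E} {P : E × E → Prop} (h : ∀ᶠ p in 𝓝 (e, e), P p) :
    ∀ᶠ u in 𝓝 e, P (u, e) :=
  (Continuous.tendsto (by fun_prop : Continuous fun u : E => (u, e)) e).eventually h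

omit [NormedSpace ℝ E] [Group G] [LieGroup 𝓘(ℝ, E) ∞ G] in
theorem eventually_const_prodMk {e : E} {P : E × E → Prop} (h : ∀ᶠ p in 𝓝 (e, e), P p) :
    ∀ᶠ u in 𝓝 e, P (e, u) :=
  (Continuous.tendsto (by fun_prop : Continuous fun u : E => (e, u)) e).eventually h

theorem chartField_eventuallyEq (X : E) :
    chartField G X =ᶠ[𝓝 (chartOne E G 1)]
      fun u => fderiv ℝ (chartMul E G) (u, chartOne E G 1) (0, X) := by
  filter_upwards [extChartAt_target_mem_nhds (I := 𝓘(ℝ, E)) (1 : G),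
    eventually_prodMk_const (eventually_differentiableAt_chartMul (E := E) (G := G))] with u hu hd
  rw [← fderiv_comp_prodMk_right hd]
  exact chartField_eq_fderiv_chartMul hu

omit [Group G] [LieGroup 𝓘(ℝ, E) ∞ G] in
theorem hasFDerivAt_fderiv_prodMk_const {f : E × E → E} {e : E}
    (hf : DifferentiableAt ℝ (fderiv ℝ f) (e, e)) (v : E × E) :
    HasFDerivAt (fun u => fderiv ℝ f (u, e) v)
     (((ContinuousLinearMap.apply ℝ E v).comp (fderiv ℝ (fderiv ℝ f) (e, e))).comp
      (ContinuousLinearMap.inl ℝ E E)) e := by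
  have h1 : HasFDerivAt (fun u : E => (u, e)) (ContinuousLinearMap.inl ℝ E E) e :=
    (hasFDerivAt_id e).prodMk (hasFDerivAt_const e e)
  have h := HasFDerivAt.comp e (g := fderiv ℝ f) (f := fun u => (u, e)) hf.hasFDerivAt h1
  exact (ContinuousLinearMap.apply ℝ E v).hasFDerivAt.comp e h

omit [Group G] [LieGroup 𝓘(ℝ, E) ∞ G] in
theorem hasFDerivAt_fderiv_const_prodMk {f : E × E → E} {e : E}
    (hf : DifferentiableAt ℝ (fderiv ℝ f) (e, e)) :
    HasFDerivAt (fun u => fderiv ℝ f (e, u))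
     ((fderiv ℝ (fderiv ℝ f) (e, e)).comp (ContinuousLinearMap.inr ℝ E E)) e := by
  have h1 : HasFDerivAt (fun u : E => (e, u)) (ContinuousLinearMap.inr ℝ E E) e :=
    (hasFDerivAt_const e e).prodMk (hasFDerivAt_id e)
  exact HasFDerivAt.comp e (g := fderiv ℝ f) hf.hasFDerivAt h1

variable (G) in
/-- The bracket of the Lie algebra of `G`, with the Lie algebra read as the model space `E`. -/
noncomputable def modelBracket [CompleteSpace E] (X Y : E) : E :=
  Bracket.bracket (L := GroupLieAlgebra 𝓘(ℝ, E) G) (M := GroupLieAlgebra 𝓘(ℝ, E) G) X Y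

/-- The bracket is the antisymmetrization of the mixed second derivative of the multiplication. -/
theorem modelBracket_eq_chart [CompleteSpace E] (X Y : E) :
    modelBracket G X Y =
      fderiv ℝ (fderiv ℝ (chartMul E G)) (chartOne E G 1, chartOne E G 1) (X, 0) (0, Y) -
      fderiv ℝ (fderiv ℝ (chartMul E G)) (chartOne E G 1, chartOne E G 1) (Y, 0) (0, X) := by
  have h1 : modelBracket G X Y =
      VectorField.lieBracket ℝ (chartField G X) (chartField G Y) (chartOne E G 1) := by
    have h := VectorField.mlieBracketWithin_apply (I := 𝓘(ℝ, E)) (s := Set.univ) (x₀ := (1 : G))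
      (V := mulInvariantVectorField X) (W := mulInvariantVectorField Y)
    have hid : (mfderiv 𝓘(ℝ, E) 𝓘(ℝ, E) (extChartAt 𝓘(ℝ, E) (1 : G)) 1 : E →L[ℝ] E) =
      ContinuousLinearMap.id ℝ E := mfderiv_extChartAt_self
    refine h.trans ((congrArg (fun A : E →L[ℝ] E => A.inverse
      (VectorField.lieBracketWithin ℝ (chartField G X) (chartField G Y)
      ((extChartAt 𝓘(ℝ, E) (1 : G)).symm ⁻¹' Set.univ ∩ Set.range 𝓘(ℝ, E))
      (chartOne E G 1))) hid).trans ?_)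
    simp
  rw [h1, VectorField.lieBracket_eq]
  simp only
  rw [(chartField_eventuallyEq X).fderiv_eq, (chartField_eventuallyEq Y).fderiv_eq,
    (chartField_eventuallyEq X).self_of_nhds, (chartField_eventuallyEq Y).self_of_nhds]
  simp only
  rw [fderiv_chartMul_zero_left, fderiv_chartMul_zero_left,
    (hasFDerivAt_fderiv_prodMk_const differentiableAt_fderiv_chartMul _).fderiv,
    (hasFDerivAt_fderiv_prodMk_const differentiableAt_fderiv_chartMul _).fderiv]
  simp

theorem lieAd_chartOneSymm_eventuallyEq (Y : E) :
    (fun u => lieAd (chartOneSymm E G u) Y) =ᶠ[𝓝 (chartOne E G 1)]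
      fun u => fderiv ℝ (chartConj E G) (u, chartOne E G 1) (0, Y) := by
  filter_upwards [eventually_prodMk_const
    (eventually_differentiableAt_chartConj (E := E) (G := G))] with u hd
  rw [← fderiv_comp_prodMk_right hd]
  unfold lieAd
  rw [mD_one_eq_fderiv (mdifferentiableAt_conj _ _) (by simp)]
  rfl

/-- The derivative of `g ↦ Ad g Y` at the identity is `X ↦ ⁅X, Y⁆`. -/
theorem hasFDerivAt_lieAd_chartOneSymm [CompleteSpace E] (Y : E) :
    ∃ A : E →L[ℝ] E, HasFDerivAt (fun u => lieAd (chartOneSymm E G u) Y) A (chartOne E G 1) ∧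
      ∀ X, A X = modelBracket G X Y := by
  set e := chartOne E G 1 with he
  set A := ((ContinuousLinearMap.apply ℝ E ((0 : E), Y)).comp
    (fderiv ℝ (fderiv ℝ (chartConj E G)) (e, e))).comp (ContinuousLinearMap.inl ℝ E E) with hA
  have hAd : HasFDerivAt (fun u => lieAd (chartOneSymm E G u) Y) A e :=
    (hasFDerivAt_fderiv_prodMk_const differentiableAt_fderiv_chartConj _).congr_of_eventuallyEq
      (lieAd_chartOneSymm_eventuallyEq Y)
  refine ⟨A, hAd, fun X => ?_⟩
  -- With `m` the multiplication in the chart, `(x y x⁻¹) x = x y` differentiated in `y` at the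
  -- identity gives `D₁ m (e, x) (Ad x Y) = D₂ m (x, e) Y`, which is differentiated in `x` at `e`.
  have h1 : (fun u => fderiv ℝ (chartMul E G) (e, u) (lieAd (chartOneSymm E G u) Y, 0)) =ᶠ[𝓝 e]
      fun u => fderiv ℝ (chartMul E G) (u, e) (0, Y) := by
    filter_upwards [eventually_prodMk_const
        (eventually_chartMul_chartConj (E := E) (G := G)).eventually_nhds,
      eventually_prodMk_const (eventually_differentiableAt_chartMul (E := E) (G := G)),
      eventually_const_prodMk (eventually_differentiableAt_chartMul (E := E) (G := G)),
      eventually_prodMk_const (eventually_differentiableAt_chartConj (E := E) (G := G)),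
      lieAd_chartOneSymm_eventuallyEq (G := G) Y] with u hu hm hm' hc hAu
    rw [hAu]
    have hcu : chartConj E G (u, e) = e := by
      simp [chartConj, he, chartOneSymm_chartOne_one]
    have h2 : (fun v => chartMul E G (chartConj E G (u, v), u)) =ᶠ[𝓝 e]
        fun v => chartMul E G (u, v) :=
      (Continuous.tendsto (by fun_prop : Continuous fun v : E => (u, v)) e).eventually hu
    have h3 := h2.fderiv_eq (𝕜 := ℝ)
    have h4 : HasFDerivAt (fun v : E => (u, v)) (ContinuousLinearMap.inr ℝ E E) e :=
       (hasFDerivAt_const u e).prodMk (hasFDerivAt_id e)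
    have h5 : HasFDerivAt (fun v => chartConj E G (u, v))
        ((fderiv ℝ (chartConj E G) (u, e)).comp (ContinuousLinearMap.inr ℝ E E)) e :=
      HasFDerivAt.comp e (g := chartConj E G) (f := fun v : E => (u, v)) hc.hasFDerivAt h4
    have h6 := h5.prodMk (hasFDerivAt_const (𝕜 := ℝ) u e)
    have h7 : HasFDerivAt (chartMul E G) (fderiv ℝ (chartMul E G) (e, u))
        (chartConj E G (u, e), u) := by
      rw [hcu]; exact hm'.hasFDerivAt
    have h8 := HasFDerivAt.comp e (g := chartMul E G)
      (f := fun v => (chartConj E G (u, v), u)) h7 h6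
    have h9 := congrArg (fun B : E →L[ℝ] E => B Y) (h8.fderiv.symm.trans h3)
    rw [fderiv_comp_prodMk_right hm] at h9
    rw [← h9, ← he]
    simp
  have h2 := hasFDerivAt_fderiv_const_prodMk (differentiableAt_fderiv_chartMul (E := E) (G := G))
  have h3 := h2.clm_apply (hAd.prodMk (hasFDerivAt_const (0 : E) e))
  have h4 := hasFDerivAt_fderiv_prodMk_const
    (differentiableAt_fderiv_chartMul (E := E) (G := G)) (0, Y)
  have h5 := congrArg (fun B : E →L[ℝ] E => B X)
    (h3.fderiv.symm.trans (h1.fderiv_eq.trans h4.fderiv))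
  have h6 := ((contDiffAt_chartMul (E := E) (G := G)).isSymmSndFDerivAt
    (by rw [minSmoothness_of_isRCLikeNormedField]; norm_cast)) (0, X) (Y, 0)
  rw [modelBracket_eq_chart]
  have h7 : lieAd (chartOneSymm E G (chartOne E G 1)) Y = Y := by
    rw [chartOneSymm_chartOne_one, lieAd_one]
  simp only [add_apply, ContinuousLinearMap.comp_apply,
    ContinuousLinearMap.prod_apply, ContinuousLinearMap.flip_apply, zero_apply,
    ContinuousLinearMap.inr_apply, ContinuousLinearMap.inl_apply,
    ContinuousLinearMap.apply_apply] at h5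
  rw [h7, fderiv_chartMul_zero_right, h6] at h5
  exact eq_sub_of_add_eq h5

end ChartCalculus

/-! ### Curves near the identity and the derivative of the adjoint representation -/

section ChartCurves

variable {E : Type*} [NormedAddCommGroup E] [NormedSpace ℝ E]
  {G : Type*} [TopologicalSpace G] [ChartedSpace E G] [Group G] [LieGroup 𝓘(ℝ, E) ∞ G]

theorem HasVelocity.hasDerivAt_chartOne {g : ℝ → G} {v : E} {t : ℝ} (hg : HasVelocity g v t)
    (h1 : g t = 1) : HasDerivAt (fun s => chartOne E G (g s)) v t := by
  have hφ : MDifferentiableAt 𝓘(ℝ, E) 𝓘(ℝ, E) (chartOne E G) (g t) := by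
    rw [h1]; exact contMDiffAt_chartOne.mdifferentiableAt (by simp)
  have h2 : mDE (chartOne E G) (g t) = ContinuousLinearMap.id ℝ E := by
    rw [h1]; exact mfderiv_extChartAt_self
  have h3 := hφ.hasMFDerivAt.comp t hg
  have h4 : HasFDerivAt (fun s => chartOne E G (g s))
    ((mDE (chartOne E G) (g t)).comp ((1 : ℝ →L[ℝ] ℝ).smulRight v)) t :=
    hasMFDerivAt_iff_hasFDerivAt.1 h3
  rw [h2] at h4
  simpa using h4.hasDerivAt

theorem hasVelocity_chartOneSymm {u : ℝ → E} {u' : E} {t : ℝ} (hu : HasDerivAt u u' t)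
    (ht : u t ∈ (extChartAt 𝓘(ℝ, E) (1 : G)).target) :
    ∃ v : E, HasVelocity (fun s => chartOneSymm E G (u s)) v t := by
  have h1 : MDifferentiableAt 𝓘(ℝ, E) 𝓘(ℝ, E) (chartOneSymm E G) (u t) := by
    have := mdifferentiableWithinAt_extChartAt_symm (I := 𝓘(ℝ, E)) ht
    rwa [ModelWithCorners.range_eq_univ, mdifferentiableWithinAt_univ] at this
  have h2 : HasMFDerivAt 𝓘(ℝ, ℝ) 𝓘(ℝ, E) u t ((1 : ℝ →L[ℝ] ℝ).smulRight u') :=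
    hu.hasFDerivAt.hasMFDerivAt
  exact ⟨_, HasCurveDeriv.hasVelocity (h1.hasMFDerivAt.comp t h2) rfl⟩

variable (E) in
/-- Points near the identity lie on curves, defined for all times, that start at the identity and
have a continuous logarithmic derivative. -/
theorem eventually_exists_hasLogDeriv :
    ∀ᶠ g in 𝓝 (1 : G), ∃ (c : ℝ → G) (ξ : ℝ → E) (T : ℝ), c 0 = 1 ∧ c T = g ∧
      HasLogDeriv c ξ ∧ Continuous ξ := by
  have hdiv : ∀ᶠ p in 𝓝 (chartOne E G 1, chartOne E G 1), ContDiffAt ℝ 1 (chartDiv E G) p :=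
    ((contDiffAt_chartDiv (E := E) (G := G)).of_le (m := 1) (by simp)).eventually (by simp)
  have hdiag : ∀ᶠ u in 𝓝 (chartOne E G 1), ContDiffAt ℝ 1 (chartDiv E G) (u, u) :=
    (Continuous.tendsto (by fun_prop : Continuous fun u : E => (u, u)) _).eventually hdiv
  obtain ⟨r, hr, hball⟩ := Metric.eventually_nhds_iff_ball.1
    (hdiag.and (extChartAt_target_mem_nhds (I := 𝓘(ℝ, E)) (1 : G)))
  have hcont : Filter.Tendsto (chartOne E G) (𝓝 1) (𝓝 (chartOne E G 1)) :=
    (contMDiffAt_chartOne (E := E) (G := G)).continuousAt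
  filter_upwards [eventually_chartOneSymm_chartOne (E := E) (G := G),
    hcont.eventually (Metric.ball_mem_nhds _ hr)] with g hg hgr
  set e := chartOne E G 1 with he
  set w := chartOne E G g - e with hw
  -- The sine keeps the curve inside the domain of the chart for all times.
  set u : ℝ → E := fun t => e + Real.sin t • w with hu
  have hub : ∀ t, u t ∈ Metric.ball e r := by
    intro t
    simp only [hu, Metric.mem_ball, dist_self_add_left, norm_smul]
    calc ‖Real.sin t‖ * ‖w‖ ≤ 1 * ‖w‖ := by
          gcongr; exact Real.abs_sin_le_one t
      _ < r := by rw [one_mul, hw, ← dist_eq_norm]; exact hgr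
  have hu' : ∀ t, HasDerivAt u (Real.cos t • w) t := fun t =>
    ((Real.hasDerivAt_sin t).smul_const w).const_add e
  set c : ℝ → G := fun t => chartOneSymm E G (u t) with hc
  have hv : ∀ t, ∃ v : E, HasVelocity c v t := fun t =>
    hasVelocity_chartOneSymm (hu' t) (hball _ (hub t)).2
  choose v hv using hv
  set ξ : ℝ → E := fun t => mD (fun y => (c t)⁻¹ * y) (c t) (v t) with hξ
  refine ⟨c, ξ, Real.pi / 2, by simp [hc, hu, he, chartOneSymm_chartOne_one],
    by simp [hc, hu, hw, hg], ?_, ?_⟩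
  · intro t
    have h := mD_comp (f := fun y => c t * y) (g := fun y => (c t)⁻¹ * y) (x := c t)
      (mdifferentiableAt_mul_left' _ _) (mdifferentiableAt_mul_left' _ _) (v t)
    simp only [mul_inv_cancel_left, mD_id, inv_mul_cancel] at h
    exact h ▸ hv t
  · have hξ2 : ∀ t, ξ t = fderiv ℝ (chartDiv E G) (u t, u t) (0, Real.cos t • w) := by
      intro t
      have h1 := ((hv t).comp (mdifferentiableAt_mul_left' (c t)⁻¹ (c t))).hasDerivAt_chartOne
        (by simp)
      have h2 := (hball _ (hub t)).1.differentiableAt (by simp)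
      have h3 := HasFDerivAt.comp_hasDerivAt t (f := fun s => (u t, u s)) h2.hasFDerivAt
        ((hasDerivAt_const t (u t)).prodMk (hu' t))
      exact h1.unique h3
    rw [show ξ = _ from funext hξ2, continuous_iff_continuousAt]
    intro t
    have h2 : ContinuousAt (fderiv ℝ (chartDiv E G)) (u t, u t) :=
      (((hball _ (hub t)).1).fderiv_right (m := 0) (by simp)).continuousAt
    have huc : Continuous u := by fun_prop
    have h3 : ContinuousAt (fun t => fderiv ℝ (chartDiv E G) (u t, u t)) t :=
      ContinuousAt.comp (f := fun t => (u t, u t)) h2 (by fun_prop)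
    exact h3.clm_apply (by fun_prop)

variable [T2Space G] [CompleteSpace E]

theorem hasDerivAt_lieAd_modelExp (X Y : E) (t : ℝ) :
    HasDerivAt (fun t : ℝ => lieAd (modelExp G (t • X)) Y)
      (lieAd (modelExp G (t • X)) (modelBracket G X Y)) t := by
  have h0 : HasDerivAt (fun t : ℝ => lieAd (modelExp G (t • X)) Y) (modelBracket G X Y) 0 := by
    have h1 := (hasLogDeriv_modelExp (G := G) X 0).hasDerivAt_chartOne (by simp [modelExp_zero])
    simp only [zero_smul, modelExp_zero, one_mul, mD_id] at h1
    obtain ⟨A, hA, hAX⟩ := hasFDerivAt_lieAd_chartOneSymm (G := G) Y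
    have h2 : HasFDerivAt (fun u => lieAd (chartOneSymm E G u) Y) A
        (chartOne E G (modelExp G ((0 : ℝ) • X))) := by
      simpa [modelExp_zero] using hA
    have h3 := HasFDerivAt.comp_hasDerivAt (0 : ℝ)
      (f := fun t : ℝ => chartOne E G (modelExp G (t • X))) h2 h1
    rw [hAX] at h3
    refine h3.congr_of_eventuallyEq ?_
    have hc : Filter.Tendsto (fun t : ℝ => modelExp G (t • X)) (𝓝 0) (𝓝 1) := by
      have := HasMFDerivAt.continuousAt (hasLogDeriv_modelExp (G := G) X 0)
      simpa [ContinuousAt, modelExp_zero] using this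
    filter_upwards [hc.eventually (eventually_chartOneSymm_chartOne (E := E) (G := G))] with t ht
    simp [ht]
  have h1 : (fun s : ℝ => lieAd (modelExp G (s • X)) Y) =
      fun s => lieAd (modelExp G (t • X)) (lieAd (modelExp G ((s - t) • X)) Y) := by
    funext s
    rw [← lieAd_mul, ← modelExp_add_smul]
    simp
  rw [h1]
  have h2 : HasDerivAt (fun s : ℝ => lieAd (modelExp G ((s - t) • X)) Y)
      (modelBracket G X Y) t := by
    have h3 : HasDerivAt (fun s : ℝ => s - t) 1 t := (hasDerivAt_id t).sub_const t
    have := HasDerivAt.scomp (g₁ := fun t : ℝ => lieAd (modelExp G (t • X)) Y) t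
      (by simpa using h0) h3
    simpa [Function.comp_def] using this
  exact (lieAd (modelExp G (t • X))).hasFDerivAt.comp_hasDerivAt t h2

end ChartCurves

/-! ### Exponential calculus in nilpotent Lie algebras -/

/-- The properties of the exponential map and the adjoint representation of a Lie group `G` with
Lie algebra `L` that suffice to compute with products of exponentials. The topology of `G` enters
only through the relation `LogDeriv` between curves and their logarithmic derivatives. The
derivative of `Ad` is tested against linear functionals because `L` carries no norm. -/
structure ExpCalculus (L G : Type*) [LieRing L] [LieAlgebra ℝ L] [Group G] where
  /-- The exponential map. -/
  exp : L → G
  /-- The adjoint representation. -/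
  Ad : G → L →ₗ[ℝ] L
  /-- `LogDeriv g ξ`: the curve `g` satisfies `g' = g ξ`. -/
  LogDeriv : (ℝ → G) → (ℝ → L) → Prop
  exp_zero : exp 0 = 1
  exp_add_smul : ∀ (s t : ℝ) (X : L), exp ((s + t) • X) = exp (s • X) * exp (t • X)
  exp_Ad : ∀ (g : G) (X : L), exp (Ad g X) = g * exp X * g⁻¹
  Ad_one : ∀ X, Ad 1 X = X
  hasDerivAt_Ad : ∀ (X Y : L) (l : L →ₗ[ℝ] ℝ) (t : ℝ),
    HasDerivAt (fun t : ℝ => l (Ad (exp (t • X)) Y)) (l (Ad (exp (t • X)) ⁅X, Y⁆)) t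
  logDeriv_mul : ∀ {g h : ℝ → G} {ξ η : ℝ → L}, LogDeriv g ξ → LogDeriv h η →
    LogDeriv (fun t => g t * h t) (fun t => Ad (h t)⁻¹ (ξ t) + η t)
  logDeriv_exp : ∀ {c c' : ℝ → ℝ} (X : L), (∀ t, HasDerivAt c (c' t) t) →
    LogDeriv (fun t => exp (c t • X)) (fun t => c' t • X)
  eq_of_logDeriv_zero : ∀ {g : ℝ → G}, LogDeriv g (fun _ => 0) → ∀ t, g t = g 0

/-- A descending filtration of a Lie algebra that starts with the whole algebra at index `1`, is
compatible with brackets and reaches zero. Its existence expresses that `L` is nilpotent. -/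
structure NilpotentFiltration (L : Type*) [LieRing L] [LieAlgebra ℝ L] where
  /-- The terms of the filtration. -/
  F : ℕ → Submodule ℝ L
  /-- The filtration vanishes beyond `length`. -/
  length : ℕ
  F_one : F 1 = ⊤
  F_succ_le : ∀ i, F (i + 1) ≤ F i
  F_length : F (length + 1) = ⊥
  lie_mem : ∀ {i j x y}, x ∈ F i → y ∈ F j → ⁅x, y⁆ ∈ F (i + j)

/-- A flag of ideals `k ⊃ k ⊓ ker l ⊃ ⋯ ⊃ ⊥`, each of codimension one in the preceding term
and containing its brackets, together with complementary vectors `X` that satisfy `P`. -/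
inductive AdaptedFlag {L : Type*} [LieRing L] [LieAlgebra ℝ L] (P : L → Prop) :
    Submodule ℝ L → Prop
  | bot : AdaptedFlag P ⊥
  | step (k : Submodule ℝ L) (X : L) (l : L →ₗ[ℝ] ℝ) (hP : P X) (hX : X ∈ k) (hl : l X = 1)
      (hk : ∀ a ∈ k, ∀ b ∈ k, ⁅a, b⁆ ∈ k ⊓ LinearMap.ker l)
      (h : AdaptedFlag P (k ⊓ LinearMap.ker l)) : AdaptedFlag P k

theorem AdaptedFlag.mono {L : Type*} [LieRing L] [LieAlgebra ℝ L] {P Q : L → Prop}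
    (hPQ : ∀ x, P x → Q x) {k : Submodule ℝ L} (h : AdaptedFlag P k) : AdaptedFlag Q k := by
  induction h with
  | bot => exact .bot
  | step k X l hP hX hl hk _ ih => exact .step k X l (hPQ _ hP) hX hl hk ih

namespace NilpotentFiltration

variable {L : Type*} [LieRing L] [LieAlgebra ℝ L] (Φ : NilpotentFiltration L)

include Φ

theorem mem_F_one (x : L) : x ∈ Φ.F 1 := by rw [Φ.F_one]; trivial

theorem antitone : Antitone Φ.F := antitone_nat_of_succ_le Φ.F_succ_le

theorem ad_pow_mem (X Y : L) (m : ℕ) : ((LieAlgebra.ad ℝ L X) ^ m) Y ∈ Φ.F (m + 1) := by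
  induction m with
  | zero => simpa using Φ.mem_F_one Y
  | succ m ih =>
    rw [pow_succ', Module.End.mul_apply, LieAlgebra.ad_apply, add_comm]
    exact Φ.lie_mem (Φ.mem_F_one X) ih

theorem ad_pow_eq_zero (X Y : L) : ((LieAlgebra.ad ℝ L X) ^ Φ.length) Y = 0 := by
  have := Φ.ad_pow_mem X Y Φ.length
  rwa [Φ.F_length, Submodule.mem_bot] at this

/-- A nonzero subspace of a nilpotent Lie algebra is not spanned by its own brackets. -/
theorem exists_notMem_of_ne_bot {k : Submodule ℝ L} (hk : k ≠ ⊥) :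
    ∃ x ∈ k, x ∉ Submodule.span ℝ {z | ∃ a ∈ k, ∃ b ∈ k, ⁅a, b⁆ = z} := by
  by_contra! h
  refine hk (eq_bot_iff.2 ?_)
  have key : ∀ i, k ≤ Φ.F (i + 1) := by
    intro i
    induction i with
    | zero => intro x _; exact Φ.mem_F_one x
    | succ i ih =>
      intro x hx
      refine Submodule.span_le.2 ?_ (h x hx)
      rintro _ ⟨a, ha, b, hb, rfl⟩
      exact Φ.antitone (by omega) (Φ.lie_mem (ih ha) (ih hb))
  exact (key _).trans Φ.F_length.le

theorem adaptedFlag [FiniteDimensional ℝ L] (k : Submodule ℝ L)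
    (hk : ∀ a ∈ k, ∀ b ∈ k, ⁅a, b⁆ ∈ k) : AdaptedFlag (· ∈ k) k := by
  induction hn : Module.finrank ℝ k using Nat.strong_induction_on generalizing k with
  | _ n ih =>
    by_cases hbot : k = ⊥
    · subst hbot; exact .bot
    obtain ⟨x, hx, hx'⟩ := Φ.exists_notMem_of_ne_bot hbot
    obtain ⟨l, hlx, hl⟩ := Submodule.exists_le_ker_of_notMem hx'
    have hbr : ∀ a ∈ k, ∀ b ∈ k, ⁅a, b⁆ ∈ k ⊓ LinearMap.ker l := fun a ha b hb =>
      ⟨hk a ha b hb, hl (Submodule.subset_span ⟨a, ha, b, hb, rfl⟩)⟩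
    have hlt : k ⊓ LinearMap.ker l < k := by
      refine lt_of_le_of_ne inf_le_left fun he => hlx ?_
      have : x ∈ k ⊓ LinearMap.ker l := by rw [he]; exact hx
      exact this.2
    refine .step k ((l x)⁻¹ • x) l (k.smul_mem _ hx) (k.smul_mem _ hx) (by simp [hlx]) hbr ?_
    exact (ih _ (hn ▸ Submodule.finrank_lt_finrank_of_lt hlt) _
      (fun a ha b hb => hbr a (Submodule.mem_inf.1 ha).1 b (Submodule.mem_inf.1 hb).1) rfl).mono
        fun x hx => (Submodule.mem_inf.1 hx).1

end NilpotentFiltration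

namespace ExpCalculus

variable {L G : Type*} [LieRing L] [LieAlgebra ℝ L] [Group G]
  (e : ExpCalculus L G)

theorem exp_neg (X : L) : e.exp (-X) = (e.exp X)⁻¹ := by
  have := e.exp_add_smul (-1) 1 X
  simp only [neg_add_cancel, zero_smul, e.exp_zero, neg_smul, one_smul] at this
  exact eq_inv_of_mul_eq_one_left this.symm

theorem exp_nsmul (n : ℕ) (X : L) : e.exp ((n : ℝ) • X) = e.exp X ^ n := by
  induction n with
  | zero => simp [e.exp_zero]
  | succ n ih => rw [Nat.cast_succ, e.exp_add_smul, ih, one_smul, pow_succ]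

theorem exp_zsmul (n : ℤ) (X : L) : e.exp ((n : ℝ) • X) = e.exp X ^ n := by
  obtain ⟨m, rfl | rfl⟩ := n.eq_nat_or_neg
  · simpa using e.exp_nsmul m X
  · simpa [e.exp_neg] using e.exp_nsmul m X

variable [FiniteDimensional ℝ L]

/-- `Ad (exp (t X)) = exp (t ad X)`, with the exponential series finite. Both sides solve the same
differential equation in `t`. -/
theorem Ad_exp_smul_of_pow_eq_zero (M : ℕ) (X Y : L) (h : ((LieAlgebra.ad ℝ L X) ^ M) Y = 0)
    (t : ℝ) : e.Ad (e.exp (t • X)) Y =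
      ∑ m ∈ Finset.range M, (t ^ m / (m.factorial : ℝ)) • ((LieAlgebra.ad ℝ L X) ^ m) Y := by
  induction M generalizing Y t with
  | zero =>
    simp only [pow_zero, Module.End.one_apply] at h
    simp [h]
  | succ M ih =>
    rw [pow_succ, Module.End.mul_apply, LieAlgebra.ad_apply] at h
    rw [← sub_eq_zero, ← Module.forall_dual_apply_eq_zero_iff ℝ]
    intro l
    have hd : ∀ t : ℝ, HasDerivAt (fun t : ℝ => l (e.Ad (e.exp (t • X)) Y -
        ∑ m ∈ Finset.range (M + 1),
          (t ^ m / (m.factorial : ℝ)) • ((LieAlgebra.ad ℝ L X) ^ m) Y)) 0 t := by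
      intro t
      have h1 := e.hasDerivAt_Ad X Y l t
      have h2 : HasDerivAt (fun t : ℝ => ∑ m ∈ Finset.range M,
          (t ^ (m + 1) / ((m + 1).factorial : ℝ)) * l (((LieAlgebra.ad ℝ L X) ^ (m + 1)) Y) +
            l Y) (∑ m ∈ Finset.range M,
          (t ^ m / (m.factorial : ℝ)) * l (((LieAlgebra.ad ℝ L X) ^ m) ⁅X, Y⁆)) t := by
        refine (HasDerivAt.fun_sum fun m _ => ?_).add_const _
        have h3 := ((hasDerivAt_pow (m + 1) t).div_const ((m + 1).factorial : ℝ)).mul_const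
          (l (((LieAlgebra.ad ℝ L X) ^ (m + 1)) Y))
        convert! h3 using 1
        rw [pow_succ (LieAlgebra.ad ℝ L X), Module.End.mul_apply, LieAlgebra.ad_apply,
          Nat.factorial_succ]
        have : (m.factorial : ℝ) ≠ 0 := by positivity
        push_cast
        field_simp
      convert! h1.sub h2 using 1
      · funext s
        simp [Finset.sum_range_succ', map_sum]
      · rw [ih _ h t]
        simp [map_sum]
    have := is_const_of_deriv_eq_zero (fun t => (hd t).differentiableAt) (fun t => (hd t).deriv) t 0
    rw [this]
    simp [Finset.sum_range_succ', e.exp_zero, e.Ad_one]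

variable (Φ : NilpotentFiltration L)
include Φ

theorem Ad_exp_smul (X Y : L) (t : ℝ) : e.Ad (e.exp (t • X)) Y =
    ∑ m ∈ Finset.range Φ.length, (t ^ m / (m.factorial : ℝ)) • ((LieAlgebra.ad ℝ L X) ^ m) Y :=
  e.Ad_exp_smul_of_pow_eq_zero _ X Y (Φ.ad_pow_eq_zero X Y) t

theorem Ad_exp (X Y : L) : e.Ad (e.exp X) Y =
    ∑ m ∈ Finset.range Φ.length, (1 / (m.factorial : ℝ)) • ((LieAlgebra.ad ℝ L X) ^ m) Y := by
  simpa using e.Ad_exp_smul Φ X Y 1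

omit [FiniteDimensional ℝ L] Φ in
theorem ad_pow_mem_of_mem {X Y : L} {k : Submodule ℝ L} (hk : ∀ Z ∈ k, ⁅X, Z⁆ ∈ k)
    (hY : Y ∈ k) (m : ℕ) : ((LieAlgebra.ad ℝ L X) ^ m) Y ∈ k := by
  induction m with
  | zero => simpa
  | succ m ih => rw [pow_succ', Module.End.mul_apply]; exact hk _ ih

theorem Ad_exp_mem {X Y : L} {k : Submodule ℝ L} (hk : ∀ Z ∈ k, ⁅X, Z⁆ ∈ k) (hY : Y ∈ k) :
    e.Ad (e.exp X) Y ∈ k := by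
  rw [e.Ad_exp Φ]
  exact k.sum_mem fun m _ => k.smul_mem _ (ad_pow_mem_of_mem hk hY m)

theorem Ad_exp_sub_mem {X Y : L} {k : Submodule ℝ L} (hk : ∀ Z ∈ k, ⁅X, Z⁆ ∈ k)
    (hY : ⁅X, Y⁆ ∈ k) : e.Ad (e.exp X) Y - Y ∈ k := by
  have h := e.Ad_exp_smul_of_pow_eq_zero (Φ.length + 1) X Y
    (by rw [pow_succ', Module.End.mul_apply, Φ.ad_pow_eq_zero, map_zero]) 1
  rw [one_smul, Finset.sum_range_succ'] at h
  rw [h]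
  simp only [pow_zero, Nat.factorial_zero, Nat.cast_one, div_one, one_smul, Module.End.one_apply,
    add_sub_cancel_right]
  refine k.sum_mem fun m _ => k.smul_mem _ ?_
  rw [pow_succ, Module.End.mul_apply]
  exact ad_pow_mem_of_mem hk hY m

theorem Ad_exp_sub_sub_mem {X Y : L} {k : Submodule ℝ L} (hk : ∀ Z ∈ k, ⁅X, Z⁆ ∈ k)
    (hY : ⁅X, ⁅X, Y⁆⁆ ∈ k) : e.Ad (e.exp X) Y - Y - ⁅X, Y⁆ ∈ k := by
  have h := e.Ad_exp_smul_of_pow_eq_zero (Φ.length + 1 + 1) X Y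
    (by rw [pow_succ', Module.End.mul_apply, pow_succ', Module.End.mul_apply, Φ.ad_pow_eq_zero,
      map_zero, map_zero]) 1
  rw [one_smul, Finset.sum_range_succ', Finset.sum_range_succ'] at h
  rw [h]
  simp only [zero_add, pow_one, Nat.factorial_one, LieAlgebra.ad_apply, pow_zero,
    Nat.factorial_zero, Nat.cast_one, div_one, one_smul, Module.End.one_apply,
    add_sub_cancel_right]
  refine k.sum_mem fun m _ => k.smul_mem _ ?_
  rw [pow_succ, Module.End.mul_apply, pow_succ, Module.End.mul_apply]
  exact ad_pow_mem_of_mem hk hY m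

theorem Ad_exp_smul_self (X : L) (c : ℝ) : e.Ad (e.exp (c • X)) X = X := by
  have := e.Ad_exp_sub_mem Φ (X := c • X) (Y := X) (k := ⊥) (by simp) (by simp)
  simpa [sub_eq_zero] using this

variable [TopologicalSpace L] [IsTopologicalAddGroup L] [ContinuousSMul ℝ L] [T2Space L]

theorem continuous_Ad_exp_smul (X : L) :
    Continuous fun p : ℝ × L => e.Ad (e.exp (p.1 • X)) p.2 := by
  simp only [e.Ad_exp_smul Φ X]
  refine continuous_finsetSum _ fun m _ => ?_
  have h1 : Continuous fun p : ℝ × L => ((LieAlgebra.ad ℝ L X) ^ m) p.2 :=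
    (LinearMap.continuous_of_finiteDimensional ((LieAlgebra.ad ℝ L X) ^ m)).comp continuous_snd
  exact Continuous.smul (by fun_prop) h1

/-- A curve `g` with logarithmic derivative `ξ` in `k` is the product of a curve `h` with
logarithmic derivative in the hyperplane `k ⊓ ker l` and a curve in the one-parameter group of `X`,
where `l X = 1`: the coefficient of `X` is the integral of `l ξ`. -/
theorem exists_logDeriv_reduction {g : ℝ → G} {ξ : ℝ → L} (hg : e.LogDeriv g ξ) (hξ : Continuous ξ)
    (h0 : g 0 = 1) {k : Submodule ℝ L} (hξk : ∀ t, ξ t ∈ k) {X : L} {l : L →ₗ[ℝ] ℝ} (hX : X ∈ k)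
    (hl : l X = 1) (hk : ∀ a ∈ k, ∀ b ∈ k, ⁅a, b⁆ ∈ k ⊓ LinearMap.ker l) :
    ∃ (h : ℝ → G) (c : ℝ → ℝ) (η : ℝ → L), e.LogDeriv h η ∧ Continuous η ∧ h 0 = 1 ∧
      (∀ t, η t ∈ k ⊓ LinearMap.ker l) ∧ (∀ t, g t = h t * e.exp (c t • X)) ∧
      (∀ t, c t = ∫ s in (0 : ℝ)..t, l (ξ s)) ∧
      ∀ t, η t = e.Ad (e.exp (c t • X)) (ξ t - l (ξ t) • X) := by
  have hlc : Continuous fun t => l (ξ t) := (LinearMap.continuous_of_finiteDimensional l).comp hξ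
  set c : ℝ → ℝ := fun t => ∫ s in (0 : ℝ)..t, l (ξ s) with hc
  have hc' : ∀ t, HasDerivAt c (l (ξ t)) t := fun t =>
    intervalIntegral.integral_hasDerivAt_right (hlc.intervalIntegrable _ _)
      hlc.aestronglyMeasurable.stronglyMeasurableAtFilter hlc.continuousAt
  have hcc : Continuous c := continuous_iff_continuousAt.2 fun t => (hc' t).continuousAt
  set η : ℝ → L := fun t => e.Ad (e.exp (c t • X)) (ξ t - l (ξ t) • X) with hη
  have hgk : e.LogDeriv (fun t => g t * e.exp ((-c t) • X)) η := by
    have := e.logDeriv_mul hg (e.logDeriv_exp (c := fun t => - c t) X fun t => (hc' t).neg)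
    convert! this using 2 with t
    rw [neg_smul, e.exp_neg, inv_inv, hη]
    simp only [map_sub, map_smul, e.Ad_exp_smul_self Φ, neg_smul]
    abel
  refine ⟨_, c, η, hgk, ?_, by simp [hc, h0, e.exp_zero], fun t => ?_, fun t => ?_, fun t => rfl,
    fun t => rfl⟩
  · exact (e.continuous_Ad_exp_smul Φ X).comp (hcc.prodMk (hξ.sub (hlc.smul continuous_const)))
  · refine e.Ad_exp_mem Φ (fun Z hZ => ?_) ⟨k.sub_mem (hξk t) (k.smul_mem _ hX), by simp [hl]⟩
    exact hk _ (k.smul_mem _ hX) _ hZ.1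
  · simp [e.exp_neg]

/-- A curve with logarithmic derivative in `k` stays in every subgroup that contains the
one-parameter groups of a flag of `k`. -/
theorem mem_of_adaptedFlag {P : L → Prop} {k : Submodule ℝ L} (hk : AdaptedFlag P k)
    {K : Subgroup G} (hK : ∀ X, P X → ∀ c : ℝ, e.exp (c • X) ∈ K)
    {g : ℝ → G} {ξ : ℝ → L} (hg : e.LogDeriv g ξ) (hξ : Continuous ξ)
    (h0 : g 0 = 1) (hξk : ∀ t, ξ t ∈ k) (t : ℝ) : g t ∈ K := by
  induction hk generalizing g ξ with
  | bot =>
    have : ξ = fun _ => 0 := funext fun t => by simpa using hξk t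
    rw [e.eq_of_logDeriv_zero (g := g) (this ▸ hg) t, h0]
    exact K.one_mem
  | step k X l hP hX hl hk _ ih =>
    obtain ⟨h, c, η, hh, hη, hh0, hηk, hgh, -, -⟩ :=
      e.exists_logDeriv_reduction Φ hg hξ h0 hξk hX hl hk
    rw [hgh t]
    exact K.mul_mem (ih hh hη hh0 hηk) (hK X hP _)

/-- If `N` is subadditive and small on short pieces of the one-parameter groups of a flag, then it
is small at the end of each curve with small logarithmic derivative. -/
theorem exists_nhds_of_adaptedFlag {P : L → Prop} {k : Submodule ℝ L} (hk : AdaptedFlag P k)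
    {N : G → ℝ} (hN1 : N 1 = 0) (hN : ∀ x y, N (x * y) ≤ N x + N y)
    (hP : ∀ X, P X → Filter.Tendsto (fun t : ℝ => N (e.exp (t • X))) (𝓝 0) (𝓝 0))
    {ε : ℝ} (hε : 0 < ε) : ∃ U ∈ 𝓝 (0 : L), ∀ {g : ℝ → G} {ξ : ℝ → L}, e.LogDeriv g ξ →
      Continuous ξ → g 0 = 1 → (∀ t, ξ t ∈ k) → (∀ t ∈ Set.Icc (0 : ℝ) 1, ξ t ∈ U) →
      N (g 1) < ε := by
  induction hk generalizing ε with
  | bot =>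
    refine ⟨Set.univ, Filter.univ_mem, fun {g ξ} hg _ h0 hξk _ => ?_⟩
    have : ξ = fun _ => 0 := funext fun t => by simpa using hξk t
    rwa [e.eq_of_logDeriv_zero (g := g) (this ▸ hg) 1, h0, hN1]
  | step k X l hPX hX hl hk _ ih =>
    obtain ⟨U, hU, ih⟩ := ih (half_pos hε)
    have hlc : Continuous l := LinearMap.continuous_of_finiteDimensional l
    have hcont : Continuous fun p : ℝ × L => e.Ad (e.exp (p.1 • X)) (p.2 - l p.2 • X) :=
      (e.continuous_Ad_exp_smul Φ X).comp (continuous_fst.prodMk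
        (continuous_snd.sub ((hlc.comp continuous_snd).smul continuous_const)))
    have hev : ∀ᶠ p : ℝ × L in 𝓝 ((0 : ℝ), (0 : L)),
        e.Ad (e.exp (p.1 • X)) (p.2 - l p.2 • X) ∈ U := by
      refine (hcont.tendsto (0, 0)).eventually_mem ?_
      simpa using hU
    rw [nhds_prod_eq] at hev
    obtain ⟨p, hp, q, hq, hpq⟩ := Filter.eventually_prod_iff.1 hev
    obtain ⟨δ, hδ, hδp⟩ := Metric.eventually_nhds_iff_ball.1
      (hp.and ((hP X hPX).eventually (gt_mem_nhds (half_pos hε))))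
    refine ⟨{Z | q Z ∧ |l Z| < δ / 2}, ?_, fun {g ξ} hg hξ h0 hξk hξU => ?_⟩
    · refine hq.and ((hlc.abs.tendsto 0).eventually (gt_mem_nhds ?_))
      simpa using half_pos hδ
    obtain ⟨h, c, η, hh, hη, hh0, hηk, hgh, hc, hηc⟩ :=
      e.exists_logDeriv_reduction Φ hg hξ h0 hξk hX hl hk
    have hcb : ∀ t ∈ Set.Icc (0 : ℝ) 1, c t ∈ Metric.ball (0 : ℝ) δ := by
      intro t ht
      have := intervalIntegral.norm_integral_le_of_norm_le_const (a := 0) (b := t) (C := δ / 2)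
        (f := fun s => l (ξ s)) (fun s hs => by
          rw [Set.uIoc_of_le ht.1] at hs
          exact (hξU s ⟨hs.1.le, hs.2.trans ht.2⟩).2.le)
      rw [mem_ball_zero_iff, hc]
      refine this.trans_lt ?_
      rw [sub_zero, abs_of_nonneg ht.1]
      nlinarith [ht.1, ht.2]
    have h1 := ih hh hη hh0 hηk fun t ht => by
      rw [hηc]
      exact hpq (hδp _ (hcb t ht)).1 (hξU t ht).1
    have h2 := (hδp _ (hcb 1 (by simp))).2
    rw [hgh 1]
    linarith [hN (h 1) (e.exp (c 1 • X))]

end ExpCalculus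

/-! ### Products and commutators of exponentials -/

namespace ExpCalculus

variable {L G : Type*} [LieRing L] [LieAlgebra ℝ L] [Group G]
  (e : ExpCalculus L G) [FiniteDimensional ℝ L] (Φ : NilpotentFiltration L)
  [TopologicalSpace L] [IsTopologicalAddGroup L] [ContinuousSMul ℝ L] [T2Space L]

include Φ

/-- The curve `exp (-t (X + Y)) exp (t X) exp (t Y)` has logarithmic derivative in `k`. -/
theorem exp_add_inv_mul_mem_closure {X Y : L} {k : Submodule ℝ L}
    (hk : ∀ a ∈ k, ∀ b ∈ k, ⁅a, b⁆ ∈ k) (hX : ∀ a ∈ k, ⁅X, a⁆ ∈ k) (hY : ∀ a ∈ k, ⁅Y, a⁆ ∈ k)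
    (hXY : ⁅X, Y⁆ ∈ k) :
    (e.exp (X + Y))⁻¹ * (e.exp X * e.exp Y) ∈ Subgroup.closure (e.exp '' k) := by
  have h1 := e.logDeriv_mul (e.logDeriv_mul
    (e.logDeriv_exp (c := fun t => -t) (X + Y) fun t => (hasDerivAt_id t).neg)
    (e.logDeriv_exp (c := fun t => t) X fun t => hasDerivAt_id t))
    (e.logDeriv_exp (c := fun t => t) Y fun t => hasDerivAt_id t)
  simp only [← e.exp_neg, ← neg_smul, one_smul] at h1
  have h2 := e.mem_of_adaptedFlag Φ (Φ.adaptedFlag k hk)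
    (K := Subgroup.closure (e.exp '' k))
    (fun Z hZ c => Subgroup.subset_closure ⟨c • Z, k.smul_mem _ hZ, rfl⟩) h1 ?_ ?_ ?_ 1
  · simpa only [one_smul, neg_smul, e.exp_neg, mul_assoc] using h2
  · have hX := e.continuous_Ad_exp_smul Φ X
    have hY := e.continuous_Ad_exp_smul Φ Y
    have h3 : Continuous fun t : ℝ => e.Ad (e.exp (-t • X)) ((-1 : ℝ) • (X + Y)) :=
      hX.comp (f := fun t : ℝ => (-t, (-1 : ℝ) • (X + Y))) (by fun_prop)
    have h4 : Continuous fun t : ℝ =>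
        e.Ad (e.exp (-t • Y)) (e.Ad (e.exp (-t • X)) ((-1 : ℝ) • (X + Y)) + X) :=
      hY.comp (f := fun t : ℝ => (-t, e.Ad (e.exp (-t • X)) ((-1 : ℝ) • (X + Y)) + X))
        (by fun_prop)
    exact h4.add (continuous_const (y := Y))
  · simp [e.exp_zero]
  · intro t
    have h3 : e.Ad (e.exp (-t • X)) Y - Y ∈ k :=
      e.Ad_exp_sub_mem Φ (fun Z hZ => by rw [smul_lie]; exact k.smul_mem _ (hX Z hZ))
        (by rw [smul_lie]; exact k.smul_mem _ hXY)
    have h4 : e.Ad (e.exp (-t • Y)) (e.Ad (e.exp (-t • X)) Y - Y) ∈ k :=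
      e.Ad_exp_mem Φ (fun Z hZ => by rw [smul_lie]; exact k.smul_mem _ (hY Z hZ)) h3
    convert! k.neg_mem h4 using 1
    simp only [map_add, map_sub, neg_one_smul, map_neg, neg_add, e.Ad_exp_smul_self Φ X (-t),
      e.Ad_exp_smul_self Φ Y (-t)]
    abel

/-- A weak form of the Baker–Campbell–Hausdorff formula: `exp X * exp Y` is `exp (X + Y)` up to an
error in any subalgebra that is stable under `ad X` and `ad Y` and contains `⁅X, Y⁆`. The proof is
by descending induction on the term of the filtration that contains the subalgebra. -/
theorem exists_exp_mul_exp {X Y : L} {k : Submodule ℝ L}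
    (hk : ∀ a ∈ k, ∀ b ∈ k, ⁅a, b⁆ ∈ k) (hX : ∀ a ∈ k, ⁅X, a⁆ ∈ k) (hY : ∀ a ∈ k, ⁅Y, a⁆ ∈ k)
    (hXY : ⁅X, Y⁆ ∈ k) : ∃ Z ∈ k, e.exp X * e.exp Y = e.exp (X + Y + Z) := by
  have key : ∀ n j : ℕ, j + n = Φ.length + 1 → ∀ (X Y : L) (k : Submodule ℝ L), k ≤ Φ.F j →
      (∀ a ∈ k, ∀ b ∈ k, ⁅a, b⁆ ∈ k) → (∀ a ∈ k, ⁅X, a⁆ ∈ k) → (∀ a ∈ k, ⁅Y, a⁆ ∈ k) →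
      ⁅X, Y⁆ ∈ k → ∃ Z ∈ k, e.exp X * e.exp Y = e.exp (X + Y + Z) := by
    intro n
    induction n with
    | zero =>
      intro j hj X Y k hkF hk hX hY hXY
      have h := e.exp_add_inv_mul_mem_closure Φ hk hX hY hXY
      have hbot : k = ⊥ := by
        rw [eq_bot_iff, ← Φ.F_length, ← hj]; exact hkF
      subst hbot
      refine ⟨0, Submodule.zero_mem _, ?_⟩
      have h2 : Subgroup.closure (e.exp '' ((⊥ : Submodule ℝ L) : Set L)) = ⊥ := by
        rw [Subgroup.closure_eq_bot_iff]
        rintro _ ⟨x, hx, rfl⟩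
        rw [SetLike.mem_coe, Submodule.mem_bot] at hx
        simp [hx, e.exp_zero]
      rw [h2, Subgroup.mem_bot, inv_mul_eq_one] at h
      rw [add_zero, h]
    | succ n ih =>
      intro j hj X Y k hkF hk hX hY hXY
      have h := e.exp_add_inv_mul_mem_closure Φ hk hX hY hXY
      set W := X + Y with hW
      have hWk : ∀ a ∈ k, ⁅W, a⁆ ∈ k := fun a ha => by
        rw [hW, add_lie]; exact k.add_mem (hX a ha) (hY a ha)
      -- `exp (W + k)` is stable under right multiplication by `exp k`
      have hstep : ∀ Z ∈ k, ∀ V ∈ k, ∃ Z' ∈ k, e.exp (W + Z) * e.exp V = e.exp (W + Z') := by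
        intro Z hZ V hV
        set m : Submodule ℝ L := Submodule.span ℝ {W} ⊔ k with hm
        set k' : Submodule ℝ L := Submodule.span ℝ {z | ∃ a ∈ m, ∃ b ∈ k, ⁅a, b⁆ = z} with hk'
        have hWm : W ∈ m := Submodule.mem_sup_left (Submodule.mem_span_singleton_self W)
        have hkm : k ≤ m := le_sup_right
        have hmk : ∀ a ∈ m, ∀ b ∈ k, ⁅a, b⁆ ∈ k := by
          intro a ha b hb
          obtain ⟨y, hy, z, hz, rfl⟩ := Submodule.mem_sup.1 ha
          obtain ⟨c, rfl⟩ := Submodule.mem_span_singleton.1 hy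
          rw [add_lie, smul_lie]
          exact k.add_mem (k.smul_mem _ (hWk b hb)) (hk z hz b hb)
        have hmk' : ∀ a ∈ m, ∀ b ∈ k, ⁅a, b⁆ ∈ k' := fun a ha b hb =>
          Submodule.subset_span ⟨a, ha, b, hb, rfl⟩
        have hk'k : k' ≤ k := by
          rw [hk', Submodule.span_le]
          rintro _ ⟨a, ha, b, hb, rfl⟩
          exact hmk a ha b hb
        have hk'F : k' ≤ Φ.F (j + 1) := by
          rw [hk', Submodule.span_le]
          rintro _ ⟨a, ha, b, hb, rfl⟩
          rw [add_comm]
          exact Φ.lie_mem (Φ.mem_F_one a) (hkF hb)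
        have hWZ : W + Z ∈ m := m.add_mem hWm (hkm hZ)
        obtain ⟨Z', hZ', he⟩ := ih (j + 1) (by omega) (W + Z) V k' hk'F
          (fun a ha b hb => hmk' a (hkm (hk'k ha)) b (hk'k hb))
          (fun a ha => hmk' _ hWZ a (hk'k ha)) (fun a ha => hmk' V (hkm hV) a (hk'k ha))
          (hmk' _ hWZ V hV)
        exact ⟨Z + V + Z', k.add_mem (k.add_mem hZ hV) (hk'k hZ'), by rw [he]; congr 1; abel⟩
      have hcl : ∀ κ ∈ Subgroup.closure (e.exp '' (k : Set L)),
          ∃ Z ∈ k, e.exp W * κ = e.exp (W + Z) := by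
        intro κ hκ
        induction hκ using Subgroup.closure_induction_right with
        | one => exact ⟨0, k.zero_mem, by simp⟩
        | mul_right x _ y hy ih =>
          obtain ⟨V, hV, rfl⟩ := hy
          obtain ⟨Z, hZ, hx⟩ := ih
          rw [← mul_assoc, hx]
          exact hstep Z hZ V hV
        | mul_inv_cancel x _ y hy ih =>
          obtain ⟨V, hV, rfl⟩ := hy
          obtain ⟨Z, hZ, hx⟩ := ih
          rw [← mul_assoc, hx, ← e.exp_neg]
          exact hstep Z hZ _ (k.neg_mem hV)
      obtain ⟨Z, hZ, he⟩ := hcl _ h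
      exact ⟨Z, hZ, by rw [← he]; group⟩
  exact key Φ.length 1 (by omega) X Y k (by rw [Φ.F_one]; exact le_top) hk hX hY hXY

/-- The exponential image of a subalgebra is a subgroup. -/
theorem exists_exp_eq_of_mem_closure {k : Submodule ℝ L} (hk : ∀ a ∈ k, ∀ b ∈ k, ⁅a, b⁆ ∈ k)
    {x : G} (hx : x ∈ Subgroup.closure (e.exp '' (k : Set L))) : ∃ Z ∈ k, e.exp Z = x := by
  have hmul : ∀ Z ∈ k, ∀ V ∈ k, ∃ Z' ∈ k, e.exp Z' = e.exp Z * e.exp V := by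
    intro Z hZ V hV
    obtain ⟨Z', hZ', h⟩ := e.exists_exp_mul_exp Φ hk (fun a ha => hk Z hZ a ha)
      (fun a ha => hk V hV a ha) (hk Z hZ V hV)
    exact ⟨_, k.add_mem (k.add_mem hZ hV) hZ', h.symm⟩
  induction hx using Subgroup.closure_induction_right with
  | one => exact ⟨0, k.zero_mem, e.exp_zero⟩
  | mul_right x _ y hy ih =>
    obtain ⟨V, hV, rfl⟩ := hy
    obtain ⟨Z, hZ, rfl⟩ := ih
    exact hmul Z hZ V hV
  | mul_inv_cancel x _ y hy ih =>
    obtain ⟨V, hV, rfl⟩ := hy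
    obtain ⟨Z, hZ, rfl⟩ := ih
    rw [← e.exp_neg]
    exact hmul Z hZ _ (k.neg_mem hV)

/-- The group commutator of two exponentials is the exponential of the bracket up to an error in any
subalgebra that is stable under `ad X` and `ad Y` and contains the triple brackets. -/
theorem exists_exp_commutator {X Y : L} {k : Submodule ℝ L}
    (hk : ∀ a ∈ k, ∀ b ∈ k, ⁅a, b⁆ ∈ k) (hX : ∀ a ∈ k, ⁅X, a⁆ ∈ k) (hY : ∀ a ∈ k, ⁅Y, a⁆ ∈ k)
    (hXXY : ⁅X, ⁅X, Y⁆⁆ ∈ k) (hYXY : ⁅Y, ⁅X, Y⁆⁆ ∈ k) :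
    ∃ Z ∈ k, e.exp X * e.exp Y * (e.exp X)⁻¹ * (e.exp Y)⁻¹ = e.exp (⁅X, Y⁆ + Z) := by
  have hW : ∀ a ∈ k, ⁅⁅X, Y⁆, a⁆ ∈ k := fun a ha => by
    rw [lie_lie]; exact k.sub_mem (hX _ (hY a ha)) (hY _ (hX a ha))
  set c := e.Ad (e.exp X) Y - Y - ⁅X, Y⁆ with hc
  have hck : c ∈ k := e.Ad_exp_sub_sub_mem Φ hX hXXY
  have hAd : e.Ad (e.exp X) Y = Y + ⁅X, Y⁆ + c := by rw [hc]; abel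
  obtain ⟨Z, hZ, h⟩ := e.exists_exp_mul_exp Φ (X := Y + ⁅X, Y⁆ + c) (Y := -Y) hk
    (fun a ha => by
      rw [add_lie, add_lie]
      exact k.add_mem (k.add_mem (hY a ha) (hW a ha)) (hk c hck a ha))
    (fun a ha => by rw [neg_lie]; exact k.neg_mem (hY a ha))
    (by
      rw [lie_neg, ← lie_skew, neg_neg, lie_add, lie_add, lie_self, zero_add]
      exact k.add_mem hYXY (hY c hck))
  refine ⟨c + Z, k.add_mem hck hZ, ?_⟩
  rw [← e.exp_Ad, hAd, ← e.exp_neg, h]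
  congr 1
  abel

theorem exists_exp_eq_of_logDeriv {g : ℝ → G} {ξ : ℝ → L} (hg : e.LogDeriv g ξ)
    (hξ : Continuous ξ) (h0 : g 0 = 1) (t : ℝ) : ∃ Z, e.exp Z = g t := by
  have hk : ∀ a ∈ (⊤ : Submodule ℝ L), ∀ b ∈ (⊤ : Submodule ℝ L), ⁅a, b⁆ ∈ (⊤ : Submodule ℝ L) :=
    fun _ _ _ _ => Submodule.mem_top
  have := e.mem_of_adaptedFlag Φ (Φ.adaptedFlag ⊤ hk)
    (K := Subgroup.closure (e.exp '' (⊤ : Submodule ℝ L)))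
    (fun Z hZ c => Subgroup.subset_closure ⟨c • Z, Submodule.mem_top, rfl⟩) hg hξ h0
    (fun _ => Submodule.mem_top) t
  obtain ⟨Z, -, hZ⟩ := e.exists_exp_eq_of_mem_closure Φ hk this
  exact ⟨Z, hZ⟩

/-- Continuity of `exp` with respect to `N`: the curve `exp (-t Y) exp (t X)` has small logarithmic
derivative `Ad (exp (-t X)) (X - Y)` when `Y` is close to `X`. -/
theorem eventually_exp_neg_mul_exp_lt {P : L → Prop} (hk : AdaptedFlag P ⊤)
    {N : G → ℝ} (hN1 : N 1 = 0) (hN : ∀ x y, N (x * y) ≤ N x + N y)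
    (hP : ∀ X, P X → Filter.Tendsto (fun t : ℝ => N (e.exp (t • X))) (𝓝 0) (𝓝 0))
    {ε : ℝ} (hε : 0 < ε) (X : L) : ∀ᶠ Y in 𝓝 X, N (e.exp (-Y) * e.exp X) < ε := by
  obtain ⟨U, hU, h⟩ := e.exists_nhds_of_adaptedFlag Φ hk hN1 hN hP hε
  have hcont : Continuous fun p : L × ℝ => e.Ad (e.exp (-p.2 • X)) (X - p.1) :=
    (e.continuous_Ad_exp_smul Φ X).comp (f := fun p : L × ℝ => (-p.2, X - p.1)) (by fun_prop)
  have hev : ∀ᶠ Y in 𝓝 X, ∀ t ∈ Set.Icc (0 : ℝ) 1, e.Ad (e.exp (-t • X)) (X - Y) ∈ U := by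
    refine isCompact_Icc.eventually_forall_of_forall_eventually fun t _ => ?_
    refine (hcont.tendsto (X, t)).eventually_mem ?_
    simpa using hU
  filter_upwards [hev] with Y hY
  have h1 := e.logDeriv_mul
    (e.logDeriv_exp (c := fun t => -t) Y fun t => (hasDerivAt_id t).neg)
    (e.logDeriv_exp (c := fun t => t) X fun t => hasDerivAt_id t)
  have h2 : (fun t : ℝ => e.Ad (e.exp (t • X))⁻¹ ((-1 : ℝ) • Y) + (1 : ℝ) • X) =
      fun t => e.Ad (e.exp (-t • X)) (X - Y) := by
    funext t
    rw [← e.exp_neg, ← neg_smul, map_sub, e.Ad_exp_smul_self Φ, map_smul]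
    simp only [neg_smul, one_smul]
    abel
  rw [h2] at h1
  simpa using h h1 (hcont.comp (f := fun t : ℝ => (Y, t)) (by fun_prop)) (by simp [e.exp_zero])
    (fun _ => Submodule.mem_top) hY

end ExpCalculus

/-! ### Stratified Lie algebras -/

namespace LieStratification

variable {L : Type*} [LieRing L] [LieAlgebra ℝ L] (S : LieStratification L)

theorem component_of_mem_same {i : ℕ} {X : L} (hX : X ∈ S.V i) : S.component i X = X := by
  let := S.isInternal.chooseDecomposition
  exact DirectSum.decompose_of_mem_same S.V hX

theorem component_of_mem_ne {i j : ℕ} {X : L} (hX : X ∈ S.V i) (hij : i ≠ j) :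
    S.component j X = 0 := by
  let := S.isInternal.chooseDecomposition
  exact DirectSum.decompose_of_mem_ne S.V hX hij

theorem component_mem (i : ℕ) (X : L) : S.component i X ∈ S.V i := by
  let := S.isInternal.chooseDecomposition
  exact (DirectSum.decompose S.V X i).2

/-- The projection to a layer as a linear map. -/
noncomputable def componentLinear (i : ℕ) : L →ₗ[ℝ] L where
  toFun := S.component i
  map_add' X Y := by
    let := S.isInternal.chooseDecomposition
    change ((DirectSum.decompose S.V (X + Y)) i : L) = _
    rw [DirectSum.decompose_add]
    rfl
  map_smul' c X := by
    let := S.isInternal.chooseDecomposition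
    change ((DirectSum.decompose S.V (c • X)) i : L) = _
    rw [DirectSum.decompose_smul]
    rfl

theorem componentLinear_apply (i : ℕ) (X : L) : S.componentLinear i X = S.component i X := rfl

theorem component_smul (i : ℕ) (c : ℝ) (X : L) : S.component i (c • X) = c • S.component i X :=
  (S.componentLinear i).map_smul c X

theorem sum_component (X : L) : ∑ i ∈ Finset.Icc 1 S.step, S.component i X = X := by
  classical
  let := S.isInternal.chooseDecomposition
  conv_rhs => rw [← DirectSum.sum_support_decompose S.V X]
  refine (Finset.sum_subset ?_ ?_).symm
  · intro i hi
    by_contra hi'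
    rw [DFinsupp.mem_support_iff] at hi
    refine hi (Subtype.ext ?_)
    have h := (DirectSum.decompose S.V X i).2
    exact (S.eq_bot i (by simp only [Finset.mem_Icc] at hi'; omega)).le h
  · intro i _ hi
    rw [DFinsupp.notMem_support_iff] at hi
    exact congrArg Subtype.val hi

theorem component_dilation (t : ℝ) (X : L) {i : ℕ} (hi : i ∈ Finset.Icc 1 S.step) :
    S.component i (S.dilation t X) = t ^ i • S.component i X := by
  rw [← S.componentLinear_apply, dilation, map_sum, Finset.sum_eq_single i]
  · rw [map_smul, componentLinear_apply, S.component_of_mem_same (S.component_mem i X)]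
  · intro j _ hj
    rw [map_smul, componentLinear_apply, S.component_of_mem_ne (S.component_mem j X) hj, smul_zero]
  · exact fun h => (h hi).elim

theorem dilation_smul (t c : ℝ) (X : L) : S.dilation t (c • X) = c • S.dilation t X := by
  simp only [dilation, component_smul, Finset.smul_sum, smul_comm c]

theorem dilation_of_mem {i : ℕ} {X : L} (hX : X ∈ S.V i) (t : ℝ) :
    S.dilation t X = t ^ i • X := by
  by_cases hi : i ∈ Finset.Icc 1 S.step
  · rw [dilation, Finset.sum_eq_single i, S.component_of_mem_same hX]
    · intro j _ hj
      rw [S.component_of_mem_ne hX hj.symm, smul_zero]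
    · exact fun h => (h hi).elim
  · rw [S.eq_bot i (by simp only [Finset.mem_Icc] at hi; omega), Submodule.mem_bot] at hX
    simp [hX, dilation, ← componentLinear_apply]

/-- The sum `V i ⊕ V (i + 1) ⊕ ⋯` of the layers from the `i`-th on. -/
def tail (i : ℕ) : Submodule ℝ L := ⨆ j, S.V (i + j)

theorem V_le_tail {i j : ℕ} (h : i ≤ j) : S.V j ≤ S.tail i := by
  obtain ⟨m, rfl⟩ := Nat.exists_eq_add_of_le h
  exact le_iSup (fun m => S.V (i + m)) m

theorem tail_le {i : ℕ} {k : Submodule ℝ L} (h : ∀ j, i ≤ j → S.V j ≤ k) : S.tail i ≤ k :=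
  iSup_le fun j => h _ (Nat.le_add_right i j)

theorem lie_V_one_mem {x y : L} {j : ℕ} (hx : x ∈ S.V 1) (hy : y ∈ S.V j) :
    ⁅x, y⁆ ∈ S.V (1 + j) := by
  by_cases hj : 1 ≤ j ∧ j < S.step
  · rw [add_comm, ← S.bracket_eq j hj.1 hj.2]
    exact Submodule.subset_span ⟨x, hx, y, hy, rfl⟩
  · by_cases hs : j = S.step
    · subst hs
      rw [S.bracket_last x hx y hy]
      exact Submodule.zero_mem _
    · rw [S.eq_bot j (by omega), Submodule.mem_bot] at hy
      simp [hy]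

theorem lie_V_mem_tail (i : ℕ) : ∀ x ∈ S.V i, ∀ j, ∀ y ∈ S.tail j, ⁅x, y⁆ ∈ S.tail (i + j) := by
  induction i with
  | zero =>
    intro x hx j y _
    rw [S.eq_bot 0 (by omega), Submodule.mem_bot] at hx
    simp [hx]
  | succ i ih =>
    have h1 : ∀ x ∈ S.V 1, ∀ j, ∀ y ∈ S.tail j, ⁅x, y⁆ ∈ S.tail (1 + j) := by
      intro x hx j y hy
      have : S.tail j ≤ (S.tail (1 + j)).comap (LieAlgebra.ad ℝ L x) :=
        S.tail_le fun m hm y hy => S.V_le_tail (by omega) (S.lie_V_one_mem hx hy)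
      exact this hy
    intro x hx j y hy
    rcases Nat.eq_zero_or_pos i with rfl | hi
    · simpa using h1 x (by simpa using hx) j y hy
    by_cases his : i < S.step
    · rw [← S.bracket_eq i hi his] at hx
      induction hx using Submodule.span_induction with
      | zero => simp
      | add a b _ _ ha hb => rw [add_lie]; exact Submodule.add_mem _ ha hb
      | smul c a _ ha => rw [smul_lie]; exact Submodule.smul_mem _ c ha
      | mem z hz =>
        obtain ⟨a, ha, b, hb, rfl⟩ := hz
        rw [lie_lie]
        refine Submodule.sub_mem _ ?_ ?_
        · rw [show i + 1 + j = 1 + (i + j) by ring]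
          exact h1 a ha _ _ (ih b hb j y hy)
        · rw [show i + 1 + j = i + (1 + j) by ring]
          exact ih b hb _ _ (h1 a ha j y hy)
    · rw [S.eq_bot (i + 1) (by omega), Submodule.mem_bot] at hx
      simp [hx]

/-- The filtration of a stratified Lie algebra by the sums of its last layers. -/
def filtration : NilpotentFiltration L where
  F := S.tail
  length := S.step
  F_one := by
    rw [eq_top_iff, ← S.isInternal.submodule_iSup_eq_top]
    refine iSup_le fun i => ?_
    rcases Nat.eq_zero_or_pos i with rfl | hi
    · rw [S.eq_bot 0 (by omega)]; exact bot_le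
    · exact S.V_le_tail hi
  F_succ_le i := S.tail_le fun j hj => S.V_le_tail (by omega)
  F_length := eq_bot_iff.2 (S.tail_le fun j hj => (S.eq_bot j (by omega)).le)
  lie_mem {i j x y} hx hy := by
    have : S.tail i ≤ (S.tail (i + j)).comap (LieAlgebra.ad ℝ L y) := by
      refine S.tail_le fun m hm x hx => ?_
      rw [Submodule.mem_comap, LieAlgebra.ad_apply, ← lie_skew]
      exact Submodule.neg_mem _
        (S.tail_le (fun a ha => S.V_le_tail (by omega)) (S.lie_V_mem_tail m x hx j y hy))
    rw [← lie_skew]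
    exact Submodule.neg_mem _ (this hx)

theorem disjoint_V_tail (i : ℕ) : Disjoint (S.V i) (S.tail (i + 1)) :=
  (S.isInternal.submodule_iSupIndep i).mono_right
    (S.tail_le fun j hj => le_iSup₂_of_le j (by omega) le_rfl)

theorem tail_eq_sup (i : ℕ) : S.tail i = S.V i ⊔ S.tail (i + 1) := by
  refine le_antisymm (S.tail_le fun j hj => ?_) (sup_le (S.V_le_tail le_rfl)
    (S.tail_le fun j hj => S.V_le_tail (by omega)))
  rcases hj.eq_or_lt with rfl | hj
  · exact le_sup_left
  · exact (S.V_le_tail hj).trans le_sup_right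

/-- The whole algebra has a flag whose complementary vectors are taken from the layers. -/
theorem adaptedFlag_top [FiniteDimensional ℝ L] : AdaptedFlag (fun X => ∃ i ≥ 1, X ∈ S.V i) ⊤ := by
  rw [← S.filtration.F_one]
  have key : ∀ n i, 1 ≤ i → i + n = S.step + 1 →
      AdaptedFlag (fun X => ∃ i ≥ 1, X ∈ S.V i) (S.tail i) := by
    intro n
    induction n with
    | zero =>
      intro i _ hin
      rw [show i = S.step + 1 by omega, show S.tail (S.step + 1) = ⊥ from S.filtration.F_length]
      exact .bot
    | succ n ih =>
      intro i hi hin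
      have hW : ∀ m, ∀ W : Submodule ℝ L, W ≤ S.V i → Module.finrank ℝ W = m →
          AdaptedFlag (fun X => ∃ i ≥ 1, X ∈ S.V i) (W ⊔ S.tail (i + 1)) := by
        intro m
        induction m using Nat.strong_induction_on with
        | _ m ihm =>
          intro W hW hm
          by_cases hbot : W = ⊥
          · rw [hbot, bot_sup_eq]
            exact ih (i + 1) (by omega) (by omega)
          obtain ⟨X, hXW, hX0⟩ := W.exists_mem_ne_zero_of_ne_bot hbot
          have hXt : X ∉ S.tail (i + 1) := fun h =>
            hX0 (Submodule.disjoint_def.1 (S.disjoint_V_tail i) X (hW hXW) h)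
          obtain ⟨l, hlX, hl⟩ := Submodule.exists_le_ker_of_notMem hXt
          have hlt : W ⊓ LinearMap.ker l < W := by
            refine lt_of_le_of_ne inf_le_left fun he => hlX ?_
            have : X ∈ W ⊓ LinearMap.ker l := by rw [he]; exact hXW
            exact this.2
          have hmod : (W ⊔ S.tail (i + 1)) ⊓ LinearMap.ker l =
              (W ⊓ LinearMap.ker l) ⊔ S.tail (i + 1) := by
            rw [sup_comm, sup_inf_assoc_of_le _ hl, sup_comm]
          have hle : W ⊔ S.tail (i + 1) ≤ S.tail i := by
            rw [S.tail_eq_sup i]; exact sup_le_sup_right hW _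
          refine .step _ ((l X)⁻¹ • X) l ⟨i, hi, (S.V i).smul_mem _ (hW hXW)⟩
            (Submodule.smul_mem _ _ (Submodule.mem_sup_left hXW)) (by simp [hlX]) ?_ ?_
          · intro a ha b hb
            have : ⁅a, b⁆ ∈ S.tail (i + 1) :=
              S.filtration.antitone (by omega : i + 1 ≤ i + i)
                (S.filtration.lie_mem (hle ha) (hle hb))
            exact ⟨Submodule.mem_sup_right this, hl this⟩
          · rw [hmod]
            exact ihm _ (hm ▸ Submodule.finrank_lt_finrank_of_lt hlt) _
              (inf_le_left.trans hW) rfl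
      rw [S.tail_eq_sup]
      exact hW _ _ le_rfl rfl
  exact key S.step 1 le_rfl (by omega)

end LieStratification

/-! ### Homogeneous norms -/

/-- `N` is a symmetric subadditive function on the group, vanishing only at the identity, and
homogeneous under the dilations: the distance to the identity for a left-invariant homogeneous
metric. No continuity is assumed. -/
structure IsHomogeneousNorm {L G : Type*} [LieRing L] [LieAlgebra ℝ L] [Group G]
    (S : LieStratification L) (e : ExpCalculus L G) (N : G → ℝ) : Prop where
  eq_zero_iff : ∀ x, N x = 0 ↔ x = 1
  inv : ∀ x, N x⁻¹ = N x
  mul_le : ∀ x y, N (x * y) ≤ N x + N y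
  dilation : ∀ t : ℝ, 0 < t → ∀ X, N (e.exp (S.dilation t X)) = t * N (e.exp X)

namespace IsHomogeneousNorm

variable {L G : Type*} [LieRing L] [LieAlgebra ℝ L] [Group G]
  {S : LieStratification L} {e : ExpCalculus L G} {N : G → ℝ} (hN : IsHomogeneousNorm S e N)

include hN

theorem map_one : N 1 = 0 := (hN.eq_zero_iff 1).2 rfl

theorem nonneg (x : G) : 0 ≤ N x := by
  have := hN.mul_le x x⁻¹
  rw [mul_inv_cancel, hN.map_one, hN.inv] at this
  linarith

theorem exp_neg (X : L) : N (e.exp (-X)) = N (e.exp X) := by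
  rw [e.exp_neg, hN.inv]

/-- In the `i`-th layer `t X` is the dilation of `X` by `t ^ (1 / i)`. -/
theorem exp_smul_of_mem {i : ℕ} (hi : 1 ≤ i) {X : L} (hX : X ∈ S.V i) (t : ℝ) :
    N (e.exp (t • X)) = |t| ^ (1 / i : ℝ) * N (e.exp X) := by
  have hi' : (1 / i : ℝ) ≠ 0 := by positivity
  have hpos : ∀ t : ℝ, 0 < t → N (e.exp (t • X)) = |t| ^ (1 / i : ℝ) * N (e.exp X) := by
    intro t ht
    rw [← hN.dilation _ (Real.rpow_pos_of_pos (abs_pos.2 ht.ne') _), S.dilation_of_mem hX,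
      ← Real.rpow_natCast, ← Real.rpow_mul (abs_nonneg _), one_div_mul_cancel (by positivity),
      Real.rpow_one, abs_of_pos ht]
  rcases lt_trichotomy t 0 with ht | rfl | ht
  · rw [← hN.exp_neg, ← neg_smul, hpos _ (neg_pos.2 ht), abs_neg]
  · rw [zero_smul, e.exp_zero, hN.map_one, abs_zero, Real.zero_rpow hi', zero_mul]
  · exact hpos t ht

theorem tendsto_exp_smul_of_mem {i : ℕ} (hi : 1 ≤ i) {X : L} (hX : X ∈ S.V i) :
    Filter.Tendsto (fun t : ℝ => N (e.exp (t • X))) (𝓝 0) (𝓝 0) := by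
  have hi' : (0 : ℝ) < 1 / i := by positivity
  have h : Continuous fun t : ℝ => |t| ^ (1 / i : ℝ) * N (e.exp X) :=
    (continuous_abs.rpow_const fun _ => Or.inr hi'.le).mul continuous_const
  have h0 := h.tendsto 0
  simp only [abs_zero, Real.zero_rpow hi'.ne', zero_mul] at h0
  simpa only [hN.exp_smul_of_mem hi hX] using h0

variable [TopologicalSpace L] [IsTopologicalAddGroup L] [ContinuousSMul ℝ L] [T2Space L]
  [FiniteDimensional ℝ L]

theorem continuous_exp : Continuous fun X => N (e.exp X) := by
  rw [continuous_iff_continuousAt]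
  intro X
  rw [ContinuousAt, Metric.tendsto_nhds]
  intro ε hε
  filter_upwards [e.eventually_exp_neg_mul_exp_lt S.filtration S.adaptedFlag_top hN.map_one
    hN.mul_le (fun X ⟨_, hi, hX⟩ => hN.tendsto_exp_smul_of_mem hi hX) hε X] with Y hY
  rw [Real.dist_eq, abs_lt]
  have h1 := hN.mul_le (e.exp Y) (e.exp (-Y) * e.exp X)
  have h2 := hN.mul_le (e.exp X) (e.exp (-Y) * e.exp X)⁻¹
  rw [hN.inv] at h2
  simp only [e.exp_neg, mul_inv_rev, inv_inv, mul_inv_cancel_left] at h1 h2 hY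
  constructor <;> linarith

/-- Injectivity of `exp` at `0`. If `exp X = 1`, then also `exp (n δ_λ X) = 1` for natural `n` and
`λ > 0`; for `λ → 0` suitable multiples `n δ_λ X` tend to any prescribed multiple of the first
nonzero component of `X`, whose one-parameter group is therefore trivial. -/
theorem eq_zero_of_exp_eq_one (hinj : ∀ X : L, (∀ t : ℝ, e.exp (t • X) = 1) → X = 0)
    {X : L} (hX : e.exp X = 1) : X = 0 := by
  classical
  by_contra hX0
  have hex : ∃ i, S.component i X ≠ 0 := by
    by_contra! h
    exact hX0 (by rw [← S.sum_component X]; exact Finset.sum_eq_zero fun i _ => h i)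
  set i := Nat.find hex
  have hi : S.component i X ≠ 0 := Nat.find_spec hex
  have hlt : ∀ j < i, S.component j X = 0 := fun j hj => not_not.1 (Nat.find_min hex hj)
  have hiS : i ∈ Finset.Icc 1 S.step := by
    by_contra h
    have := S.component_mem i X
    rw [S.eq_bot i (by simp only [Finset.mem_Icc] at h; omega), Submodule.mem_bot] at this
    exact hi this
  have hi1 : i ≠ 0 := by have := (Finset.mem_Icc.1 hiS).1; omega
  refine hi (hinj _ ?_)
  have hpos : ∀ t : ℝ, 0 ≤ t → e.exp (t • S.component i X) = 1 := by
    intro t ht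
    -- The parameter of the dilation is `x⁻¹` with `x → ∞`.
    have hlim : Filter.Tendsto
        (fun x : ℝ => ((⌊t * x ^ i⌋₊ : ℕ) : ℝ) • S.dilation x⁻¹ X) Filter.atTop
        (𝓝 (t • S.component i X)) := by
      have hfl : Filter.Tendsto (fun x : ℝ => (⌊t * x ^ i⌋₊ : ℝ) / x ^ i) Filter.atTop (𝓝 t) :=
        (tendsto_nat_floor_mul_div_atTop ht).comp (Filter.tendsto_pow_atTop hi1)
      have hj : ∀ j ∈ Finset.Icc 1 S.step, Filter.Tendsto
          (fun x : ℝ => (⌊t * x ^ i⌋₊ : ℝ) • (x⁻¹ ^ j • S.component j X)) Filter.atTop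
          (𝓝 (if j = i then t • S.component i X else 0)) := by
        intro j _
        rcases lt_trichotomy j i with hji | rfl | hji
        · simp [hlt j hji, hji.ne]
        · simpa only [smul_smul, inv_pow, ← div_eq_mul_inv, if_true] using hfl.smul_const _
        · obtain ⟨m, rfl⟩ := Nat.exists_eq_add_of_lt hji
          have hz : Filter.Tendsto (fun x : ℝ => (⌊t * x ^ i⌋₊ : ℝ) / x ^ i * (x⁻¹) ^ (m + 1))
              Filter.atTop (𝓝 (t * 0 ^ (m + 1))) := hfl.mul (tendsto_inv_atTop_zero.pow _)
          have := hz.smul_const (S.component (i + m + 1) X)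
          simp only [zero_pow (Nat.succ_ne_zero m), mul_zero, zero_smul] at this
          rw [if_neg (by omega)]
          refine this.congr fun x => ?_
          rw [smul_smul]
          congr 1
          rw [add_assoc, pow_add x⁻¹ i, div_eq_mul_inv, inv_pow x i, mul_assoc]
      have := tendsto_finsetSum _ hj
      rw [Finset.sum_ite_eq' _ _ _, if_pos hiS] at this
      simpa only [LieStratification.dilation, Finset.smul_sum] using this
    have hz : ∀ᶠ x : ℝ in Filter.atTop,
        N (e.exp (((⌊t * x ^ i⌋₊ : ℕ) : ℝ) • S.dilation x⁻¹ X)) = 0 := by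
      filter_upwards [Filter.eventually_gt_atTop 0] with x hx
      have : e.exp (S.dilation x⁻¹ X) = 1 := by
        rw [← hN.eq_zero_iff, hN.dilation _ (inv_pos.2 hx), hX, hN.map_one, mul_zero]
      rw [e.exp_nsmul, this, one_pow, hN.map_one]
    rw [← hN.eq_zero_iff]
    exact tendsto_nhds_unique ((hN.continuous_exp.tendsto _).comp hlim)
      (tendsto_const_nhds.congr' (hz.mono fun _ h => h.symm))
  intro t
  rcases le_total 0 t with ht | ht
  · exact hpos t ht
  · have := hpos (-t) (neg_nonneg.2 ht)
    rwa [neg_smul, e.exp_neg, inv_eq_one] at this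

/-- Both sides scale in the same way under dilations, so the estimate has to be checked only on a
compact set that meets each orbit of the dilations outside the origin. -/
theorem exists_exp_smul_le (hinj : ∀ X : L, (∀ t : ℝ, e.exp (t • X) = 1) → X = 0) :
    ∃ C : ℝ, 0 ≤ C ∧ ∀ X : L, ∀ t ∈ Set.Icc (0 : ℝ) 1,
      N (e.exp (t • X)) ≤ C * N (e.exp X) := by
  let φ : L ≃L[ℝ] (Fin (Module.finrank ℝ L) → ℝ) :=
    ContinuousLinearEquiv.ofFinrankEq (by simp)
  let ρ : L → ℝ := fun X => ∑ i ∈ Finset.Icc 1 S.step, ‖φ (S.component i X)‖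
  have hρ : Continuous ρ := continuous_finsetSum _ fun i _ =>
    (φ.continuous.comp (S.componentLinear i).continuous_of_finiteDimensional).norm
  have hφρ : ∀ X, ‖φ X‖ ≤ ρ X := fun X => by
    conv_lhs => rw [← S.sum_component X, map_sum]
    exact norm_sum_le _ _
  have hK : IsCompact {X | ρ X = 1} := by
    refine ((isCompact_closedBall (0 : Fin (Module.finrank ℝ L) → ℝ) 1).image
      φ.symm.continuous).of_isClosed_subset (isClosed_eq hρ continuous_const) ?_
    intro X hX
    refine ⟨φ X, ?_, φ.symm_apply_apply X⟩
    rw [mem_closedBall_zero_iff]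
    exact (hφρ X).trans (le_of_eq hX)
  have hscale : ∀ X : L, X ≠ 0 → ∃ μ > 0, ρ (S.dilation μ X) = 1 := by
    intro X hX
    have hX0 : 0 < ρ X := lt_of_lt_of_le
      (norm_pos_iff.2 fun h => hX (φ.map_eq_zero_iff.1 h)) (hφρ X)
    have hρμ : ∀ μ : ℝ, 0 ≤ μ → ρ (S.dilation μ X) =
        ∑ i ∈ Finset.Icc 1 S.step, μ ^ i * ‖φ (S.component i X)‖ := fun μ hμ =>
      Finset.sum_congr rfl fun i hi => by
        rw [S.component_dilation μ X hi, map_smul, norm_smul, norm_pow, Real.norm_of_nonneg hμ]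
    set b := max 1 (ρ X)⁻¹
    have hb1 : 1 ≤ b := le_max_left _ _
    have hcont : Continuous fun μ : ℝ =>
        ∑ i ∈ Finset.Icc 1 S.step, μ ^ i * ‖φ (S.component i X)‖ := by fun_prop
    have h0 : ∑ i ∈ Finset.Icc 1 S.step, (0 : ℝ) ^ i * ‖φ (S.component i X)‖ = 0 :=
      Finset.sum_eq_zero fun i hi => by
        rw [zero_pow (by have := (Finset.mem_Icc.1 hi).1; omega), zero_mul]
    have hb : 1 ≤ ∑ i ∈ Finset.Icc 1 S.step, b ^ i * ‖φ (S.component i X)‖ := by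
      calc (1 : ℝ) = (ρ X)⁻¹ * ρ X := (inv_mul_cancel₀ hX0.ne').symm
        _ ≤ b * ρ X := mul_le_mul_of_nonneg_right (le_max_right _ _) hX0.le
        _ = ∑ i ∈ Finset.Icc 1 S.step, b * ‖φ (S.component i X)‖ := Finset.mul_sum ..
        _ ≤ _ := Finset.sum_le_sum fun i hi => mul_le_mul_of_nonneg_right
          (le_self_pow₀ hb1 (by have := (Finset.mem_Icc.1 hi).1; omega)) (norm_nonneg _)
    obtain ⟨μ, hμ, hμ1⟩ := intermediate_value_Icc (zero_le_one.trans hb1) hcont.continuousOn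
      (⟨by simp only [h0]; exact zero_le_one, hb⟩ : (1 : ℝ) ∈ Set.Icc _ _)
    have hμ0 : μ ≠ 0 := by
      rintro rfl
      simp only [h0] at hμ1
      exact zero_ne_one hμ1
    exact ⟨μ, lt_of_le_of_ne hμ.1 hμ0.symm, by rw [hρμ μ hμ.1]; exact hμ1⟩
  have hρ0 : ρ 0 = 0 := Finset.sum_eq_zero fun i _ => by
    rw [← S.componentLinear_apply, map_zero, map_zero, norm_zero]
  have hpos : ∀ X ∈ {X | ρ X = 1}, 0 < N (e.exp X) := by
    intro X hX
    refine lt_of_le_of_ne (hN.nonneg _) fun h => ?_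
    have := hN.eq_zero_of_exp_eq_one hinj ((hN.eq_zero_iff _).1 h.symm)
    subst this
    exact zero_ne_one (hρ0.symm.trans hX)
  obtain ⟨m, hm0, hm⟩ : ∃ m > 0, ∀ X ∈ {X | ρ X = 1}, m ≤ N (e.exp X) :=
    hK.exists_forall_le' hN.continuous_exp.continuousOn hpos
  obtain ⟨M, hM⟩ := ((isCompact_Icc (a := (0 : ℝ)) (b := 1)).prod hK).bddAbove_image
    (hN.continuous_exp.comp (continuous_smul (M := ℝ) (X := L))).continuousOn
  have hM' : ∀ t ∈ Set.Icc (0 : ℝ) 1, ∀ Y, ρ Y = 1 → N (e.exp (t • Y)) ≤ max M 0 :=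
    fun t ht Y hY => (hM ⟨(t, Y), ⟨ht, hY⟩, rfl⟩).trans (le_max_left _ _)
  refine ⟨max M 0 / m, by positivity, fun X t ht => ?_⟩
  rcases eq_or_ne X 0 with rfl | hX
  · simp [e.exp_zero, hN.map_one]
  obtain ⟨μ, hμ, hY⟩ := hscale X hX
  have h1 := hM' t ht _ hY
  have h2 := hm _ hY
  rw [← S.dilation_smul, hN.dilation μ hμ] at h1
  rw [hN.dilation μ hμ] at h2
  refine le_of_mul_le_mul_left (h1.trans ?_) hμ
  rw [mul_left_comm, div_mul_eq_mul_div, le_div_iff₀ hm0]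
  exact mul_le_mul_of_nonneg_left h2 (le_max_right _ _)

end IsHomogeneousNorm

/-! ### Covering the exponential of a generated subalgebra -/

/-- The lower central series of `k`, as submodules of the ambient Lie algebra: the term with index
`0` is `k` itself, and the next term is spanned by the brackets of `k` with the current one. -/
def lowerCentralSubmodule {L : Type*} [LieRing L] [LieAlgebra ℝ L] (k : Submodule ℝ L) :
    ℕ → Submodule ℝ L
  | 0 => k
  | i + 1 => Submodule.span ℝ {z | ∃ x ∈ k, ∃ y ∈ lowerCentralSubmodule k i, ⁅x, y⁆ = z}

section LowerCentral

variable {L : Type*} [LieRing L] [LieAlgebra ℝ L] {k : Submodule ℝ L}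

theorem lie_mem_lowerCentralSubmodule_succ {i : ℕ} {x y : L} (hx : x ∈ k)
    (hy : y ∈ lowerCentralSubmodule k i) : ⁅x, y⁆ ∈ lowerCentralSubmodule k (i + 1) :=
  Submodule.subset_span ⟨x, hx, y, hy, rfl⟩

theorem lowerCentralSubmodule_antitone (hk : ∀ a ∈ k, ∀ b ∈ k, ⁅a, b⁆ ∈ k) :
    Antitone (lowerCentralSubmodule k) := by
  refine antitone_nat_of_succ_le fun i => ?_
  induction i with
  | zero =>
    refine Submodule.span_le.2 ?_
    rintro _ ⟨x, hx, y, hy, rfl⟩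
    exact hk x hx y hy
  | succ i ih =>
    refine Submodule.span_le.2 ?_
    rintro _ ⟨x, hx, y, hy, rfl⟩
    exact lie_mem_lowerCentralSubmodule_succ hx (ih hy)

theorem lie_mem_lowerCentralSubmodule_add {i : ℕ} : ∀ {j : ℕ} {x y : L},
    x ∈ lowerCentralSubmodule k i → y ∈ lowerCentralSubmodule k j →
    ⁅x, y⁆ ∈ lowerCentralSubmodule k (i + j + 1) := by
  induction i with
  | zero =>
    intro j x y hx hy
    rw [zero_add]
    exact lie_mem_lowerCentralSubmodule_succ hx hy
  | succ i ih =>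
    intro j x y hx hy
    change x ∈ Submodule.span ℝ _ at hx
    induction hx using Submodule.span_induction with
    | zero => simp
    | add a b _ _ ha hb => rw [add_lie]; exact Submodule.add_mem _ ha hb
    | smul c a _ ha => rw [smul_lie]; exact Submodule.smul_mem _ c ha
    | mem z hz =>
      obtain ⟨a, ha, b, hb, rfl⟩ := hz
      rw [lie_lie, show i + 1 + j + 1 = i + j + 1 + 1 by ring]
      refine Submodule.sub_mem _ (lie_mem_lowerCentralSubmodule_succ ha (ih hb hy)) ?_
      rw [show i + j + 1 + 1 = i + (j + 1) + 1 by ring]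
      exact ih hb (lie_mem_lowerCentralSubmodule_succ ha hy)

theorem lowerCentralSubmodule_le (Φ : NilpotentFiltration L) (i : ℕ) :
    lowerCentralSubmodule k i ≤ Φ.F (i + 1) := by
  induction i with
  | zero => exact fun x _ => Φ.mem_F_one x
  | succ i ih =>
    refine Submodule.span_le.2 ?_
    rintro _ ⟨x, hx, y, hy, rfl⟩
    rw [add_comm]
    exact Φ.lie_mem (Φ.mem_F_one x) (ih hy)

end LowerCentral

namespace ExpCalculus

variable {L G : Type*} [LieRing L] [LieAlgebra ℝ L] [Group G]
  (e : ExpCalculus L G)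

theorem exp_smul_mem_of_int (K : Subgroup G) {Y : L} (hY : e.exp Y ∈ K) (n : ℤ) :
    e.exp ((n : ℝ) • Y) ∈ K := by
  rw [e.exp_zsmul]; exact K.zpow_mem hY n

end ExpCalculus

namespace IsHomogeneousNorm

variable {L G : Type*} [LieRing L] [LieAlgebra ℝ L] [Group G]
  {S : LieStratification L} {e : ExpCalculus L G} {N : G → ℝ} (hN : IsHomogeneousNorm S e N)
  [TopologicalSpace L] [IsTopologicalAddGroup L] [ContinuousSMul ℝ L] [T2Space L]
  [FiniteDimensional ℝ L]

include hN

/-- Modulo the next term, the `i`-th term of the lower central series of the subalgebra generated by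
the logarithms of `A` is spanned by logarithms of short elements of the group generated by `A`. -/
theorem lowerCentralSubmodule_le_span_sup (Φ : NilpotentFiltration L) {A : Set G} {r : ℝ}
    (hr : 0 ≤ r) (hA : ∀ a ∈ A, N a ≤ r)
    {k : LieSubalgebra ℝ L} (hkA : k = LieSubalgebra.lieSpan ℝ L {X | e.exp X ∈ A}) (i : ℕ) :
    lowerCentralSubmodule k.toSubmodule i ≤
      Submodule.span ℝ {Y | Y ∈ lowerCentralSubmodule k.toSubmodule i ∧
        e.exp Y ∈ Subgroup.closure A ∧ N (e.exp Y) ≤ 4 ^ i * r} ⊔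
      lowerCentralSubmodule k.toSubmodule (i + 1) := by
  have hk : ∀ a ∈ k.toSubmodule, ∀ b ∈ k.toSubmodule, ⁅a, b⁆ ∈ k.toSubmodule :=
    fun a ha b hb => k.lie_mem ha hb
  have hTk : {X | e.exp X ∈ A} ⊆ k := hkA ▸ LieSubalgebra.subset_lieSpan
  have hanti := lowerCentralSubmodule_antitone hk
  have hgen : k.toSubmodule ≤ Submodule.span ℝ {X | e.exp X ∈ A} ⊔
      lowerCentralSubmodule k.toSubmodule 1 := by
    have hle : Submodule.span ℝ {X | e.exp X ∈ A} ⊔ lowerCentralSubmodule k.toSubmodule 1 ≤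
        k.toSubmodule := sup_le (Submodule.span_le.2 hTk) (hanti zero_le_one)
    let k' : LieSubalgebra ℝ L :=
      { Submodule.span ℝ {X | e.exp X ∈ A} ⊔ lowerCentralSubmodule k.toSubmodule 1 with
        lie_mem' := fun {x y} hx hy => Submodule.mem_sup_right
          (lie_mem_lowerCentralSubmodule_succ (hle hx) (hle hy)) }
    have : k ≤ k' := by
      rw [hkA]
      exact LieSubalgebra.lieSpan_le.2 fun X hX =>
        Submodule.mem_sup_left (Submodule.subset_span hX)
    exact this
  induction i with
  | zero =>
    refine hgen.trans (sup_le_sup_right (Submodule.span_mono ?_) _)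
    intro X hX
    refine ⟨hTk hX, ?_, ?_⟩
    · exact Subgroup.subset_closure hX
    · simpa using hA _ hX
  | succ i ih =>
    refine Submodule.span_le.2 ?_
    rintro _ ⟨x, hx, y, hy, rfl⟩
    obtain ⟨a, ha, c, hc, rfl⟩ := Submodule.mem_sup.1 (hgen hx)
    obtain ⟨b, hb, d, hd, rfl⟩ := Submodule.mem_sup.1 (ih hy)
    rw [add_lie, lie_add]
    have hak : a ∈ k.toSubmodule := Submodule.span_le.2 hTk ha
    refine Submodule.add_mem _ (Submodule.add_mem _ ?_ ?_) ?_
    · refine Submodule.span_induction₂ (p := fun a b _ _ => ⁅a, b⁆ ∈ _) ?_ ?_ ?_ ?_ ?_ ?_ ?_ ha hb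
      · intro X Y hX hY
        have hXk := hTk hX
        have hYk : Y ∈ k.toSubmodule := hanti (Nat.zero_le i) hY.1
        have hXY := lie_mem_lowerCentralSubmodule_succ hXk hY.1
        obtain ⟨Z, hZ, hZe⟩ := e.exists_exp_commutator Φ (X := X) (Y := Y)
          (k := lowerCentralSubmodule k.toSubmodule (i + 2))
          (fun a ha b hb => hanti (by omega) (lie_mem_lowerCentralSubmodule_add ha hb))
          (fun a ha => hanti (by omega) (lie_mem_lowerCentralSubmodule_succ hXk ha))
          (fun a ha => hanti (by omega) (lie_mem_lowerCentralSubmodule_succ hYk ha))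
          (lie_mem_lowerCentralSubmodule_succ hXk hXY)
          (lie_mem_lowerCentralSubmodule_succ hYk hXY)
        have hXA := Subgroup.subset_closure (k := A) hX
        rw [← add_sub_cancel_right ⁅X, Y⁆ Z]
        refine Submodule.sub_mem _ (Submodule.mem_sup_left (Submodule.subset_span ⟨?_, ?_, ?_⟩))
          (Submodule.mem_sup_right hZ)
        · exact Submodule.add_mem _ hXY (hanti (Nat.le_succ _) hZ)
        · rw [← hZe]
          exact mul_mem (mul_mem (mul_mem hXA hY.2.1) (inv_mem hXA)) (inv_mem hY.2.1)
        · rw [← hZe]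
          have h1 := hN.mul_le (e.exp X * e.exp Y * (e.exp X)⁻¹) (e.exp Y)⁻¹
          have h2 := hN.mul_le (e.exp X * e.exp Y) (e.exp X)⁻¹
          have h3 := hN.mul_le (e.exp X) (e.exp Y)
          rw [hN.inv] at h1 h2
          have h4 := hA _ hX
          have h5 := hY.2.2
          have h6 : r ≤ 4 ^ i * r := le_mul_of_one_le_left hr (one_le_pow₀ (by norm_num))
          rw [pow_succ]
          linarith
      · intro Y _; rw [zero_lie]; exact Submodule.zero_mem _
      · intro X _; rw [lie_zero]; exact Submodule.zero_mem _
      · intro X X' Y _ _ _ h h'; rw [add_lie]; exact Submodule.add_mem _ h h'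
      · intro X Y Y' _ _ _ h h'; rw [lie_add]; exact Submodule.add_mem _ h h'
      · intro t X Y _ _ h; rw [smul_lie]; exact Submodule.smul_mem _ t h
      · intro t X Y _ _ h; rw [lie_smul]; exact Submodule.smul_mem _ t h
    · exact Submodule.mem_sup_right (lie_mem_lowerCentralSubmodule_succ hak hd)
    · refine Submodule.mem_sup_right (hanti ?_ (lie_mem_lowerCentralSubmodule_add hc hy))
      omega

/-- If `exp k'` lies within distance `R` of `Γ`, then `exp (∑ tⱼ fⱼ + Z)` with `Z ∈ k'` lies within
distance `m * C * ρ + R` of `Γ`, provided `exp fⱼ ∈ Γ` has norm at most `ρ`. -/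
theorem exists_closure_mul_of_sum (Φ : NilpotentFiltration L) {C : ℝ}
    (hC : ∀ X : L, ∀ t ∈ Set.Icc (0 : ℝ) 1, N (e.exp (t • X)) ≤ C * N (e.exp X)) (hC0 : 0 ≤ C)
    {Γ : Subgroup G} {k k' : Submodule ℝ L} (hk' : ∀ a ∈ k', ∀ b ∈ k', ⁅a, b⁆ ∈ k')
    (hkk' : ∀ a ∈ k, ∀ b ∈ k', ⁅a, b⁆ ∈ k') (hk : ∀ a ∈ k, ∀ b ∈ k, ⁅a, b⁆ ∈ k') (hle : k' ≤ k)
    {R ρ : ℝ} (hR : ∀ Z ∈ k', ∃ γ ∈ Γ, N (γ⁻¹ * e.exp Z) ≤ R) :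
    ∀ (m : ℕ) (f : Fin m → L) (t : Fin m → ℝ),
      (∀ j, f j ∈ k ∧ e.exp (f j) ∈ Γ ∧ N (e.exp (f j)) ≤ ρ) → ∀ Z ∈ k',
      ∃ γ ∈ Γ, N (γ⁻¹ * e.exp (∑ j, t j • f j + Z)) ≤ m * (C * ρ) + R := by
  intro m
  induction m with
  | zero => intro f t _ Z hZ; simpa using hR Z hZ
  | succ m ih =>
    intro f t hf Z hZ
    set X := ∑ j : Fin m, t j.succ • f j.succ + Z with hX
    have hXk : X ∈ k := k.add_mem (k.sum_mem fun j _ => k.smul_mem _ (hf _).1) (hle hZ)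
    obtain ⟨hYk, hYΓ, hYρ⟩ := hf 0
    set Y := f 0
    have hexp : ∀ U ∈ k, ∀ V ∈ k, ∃ W ∈ k', e.exp U * e.exp V = e.exp (U + V + W) :=
      fun U hU V hV => e.exists_exp_mul_exp Φ hk' (hkk' U hU) (hkk' V hV) (hk U hU V hV)
    -- Write `exp (t Y + X) = exp (⌊t⌋ Y) * exp (X + Z₁ + Z₂) * exp ({t} Y)`.
    obtain ⟨Z₁, hZ₁, h₁⟩ := hexp (-((⌊t 0⌋ : ℝ) • Y)) (k.neg_mem (k.smul_mem _ hYk))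
      (t 0 • Y + X) (k.add_mem (k.smul_mem _ hYk) hXk)
    obtain ⟨Z₂, hZ₂, h₂⟩ := hexp (-((⌊t 0⌋ : ℝ) • Y) + (t 0 • Y + X) + Z₁)
      (k.add_mem (k.add_mem (k.neg_mem (k.smul_mem _ hYk))
        (k.add_mem (k.smul_mem _ hYk) hXk)) (hle hZ₁))
      (-(Int.fract (t 0) • Y)) (k.neg_mem (k.smul_mem _ hYk))
    obtain ⟨γ, hγ, hγN⟩ := ih (fun j => f j.succ) (fun j => t j.succ) (fun j => hf _)
      (Z + Z₁ + Z₂) (k'.add_mem (k'.add_mem hZ hZ₁) hZ₂)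
    have hsum : -((⌊t 0⌋ : ℝ) • Y) + (t 0 • Y + X) + Z₁ + -(Int.fract (t 0) • Y) + Z₂ =
        ∑ j : Fin m, t j.succ • f j.succ + (Z + Z₁ + Z₂) := by
      rw [Int.fract, sub_smul, hX]; abel
    rw [hsum, ← h₁, e.exp_neg, e.exp_neg] at h₂
    rw [← h₂] at hγN
    refine ⟨e.exp ((⌊t 0⌋ : ℝ) • Y) * γ, mul_mem (e.exp_smul_mem_of_int Γ hYΓ _) hγ, ?_⟩
    rw [Fin.sum_univ_succ, add_assoc, ← hX]
    have h3 := hN.mul_le (γ⁻¹ * ((e.exp ((⌊t 0⌋ : ℝ) • Y))⁻¹ * e.exp (t 0 • Y + X) *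
      (e.exp (Int.fract (t 0) • Y))⁻¹)) (e.exp (Int.fract (t 0) • Y))
    have h4 := hC Y (Int.fract (t 0)) ⟨Int.fract_nonneg _, (Int.fract_lt_one _).le⟩
    have h5 := mul_le_mul_of_nonneg_left hYρ hC0
    simp only [mul_inv_rev, mul_assoc, inv_mul_cancel, mul_one] at h3 hγN ⊢
    push_cast
    linarith

/-- If `N ≤ r` on `A`, then the exponential of the Lie subalgebra generated by the logarithms of `A`
lies within distance `K * r` of the subgroup generated by `A`, with `K` independent of `A`. -/
theorem exists_covering_constant (Φ : NilpotentFiltration L)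
    (hinj : ∀ X : L, (∀ t : ℝ, e.exp (t • X) = 1) → X = 0) :
    ∃ K : ℝ, ∀ (A : Set G) (r : ℝ), 0 ≤ r → (∀ a ∈ A, N a ≤ r) →
      ∀ X ∈ LieSubalgebra.lieSpan ℝ L {X | e.exp X ∈ A},
        ∃ γ ∈ Subgroup.closure A, N (γ⁻¹ * e.exp X) ≤ K * r := by
  obtain ⟨C, hC0, hC⟩ := hN.exists_exp_smul_le hinj
  have key : ∀ n i : ℕ, i + n = Φ.length → ∃ K : ℝ, ∀ (A : Set G) (r : ℝ), 0 ≤ r →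
      (∀ a ∈ A, N a ≤ r) →
      ∀ X ∈ lowerCentralSubmodule
        (LieSubalgebra.lieSpan ℝ L {X | e.exp X ∈ A}).toSubmodule i,
        ∃ γ ∈ Subgroup.closure A, N (γ⁻¹ * e.exp X) ≤ K * r := by
    intro n
    induction n with
    | zero =>
      intro i hi
      refine ⟨0, fun A r _ _ X hX => ⟨1, one_mem _, ?_⟩⟩
      have h0 := lowerCentralSubmodule_le Φ i hX
      rw [show i = Φ.length by omega, Φ.F_length, Submodule.mem_bot] at h0
      simp [h0, e.exp_zero, hN.map_one]
    | succ n ih =>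
      intro i hi
      obtain ⟨K, hK⟩ := ih (i + 1) (by omega)
      refine ⟨Module.finrank ℝ L * (C * 4 ^ i) + K, fun A r hr hA X hX => ?_⟩
      set k := LieSubalgebra.lieSpan ℝ L {X | e.exp X ∈ A} with hkA
      have hk : ∀ a ∈ k.toSubmodule, ∀ b ∈ k.toSubmodule, ⁅a, b⁆ ∈ k.toSubmodule :=
        fun a ha b hb => k.lie_mem ha hb
      have hanti := lowerCentralSubmodule_antitone hk
      obtain ⟨W, hW, Z, hZ, rfl⟩ := Submodule.mem_sup.1
        (hN.lowerCentralSubmodule_le_span_sup Φ hr hA hkA i hX)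
      obtain ⟨f, hf, hfspan, -⟩ := Submodule.exists_fun_fin_finrank_span_eq ℝ
        {Y | Y ∈ lowerCentralSubmodule k.toSubmodule i ∧
          e.exp Y ∈ Subgroup.closure A ∧ N (e.exp Y) ≤ 4 ^ i * r}
      rw [← hfspan, Submodule.mem_span_range_iff_exists_fun] at hW
      obtain ⟨t, rfl⟩ := hW
      obtain ⟨γ, hγ, hγN⟩ := hN.exists_closure_mul_of_sum Φ hC hC0
        (k := lowerCentralSubmodule k.toSubmodule i)
        (k' := lowerCentralSubmodule k.toSubmodule (i + 1))
        (fun a ha b hb => hanti (by omega) (lie_mem_lowerCentralSubmodule_add ha hb))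
        (fun a ha b hb => hanti (by omega) (lie_mem_lowerCentralSubmodule_add ha hb))
        (fun a ha b hb => hanti (by omega) (lie_mem_lowerCentralSubmodule_add ha hb))
        (hanti (Nat.le_succ i)) (hK A r hr hA) _ f t hf Z hZ
      refine ⟨γ, hγ, hγN.trans ?_⟩
      rw [add_mul, mul_assoc (Module.finrank ℝ L : ℝ), mul_assoc C]
      gcongr
      exact Submodule.finrank_le _
  exact key Φ.length 0 (zero_add _)

end IsHomogeneousNorm

/-! ### Counting the generated subgroups -/

namespace IsHomogeneousNorm

variable {L G : Type*} [LieRing L] [LieAlgebra ℝ L] [Group G]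
  {S : LieStratification L} {e : ExpCalculus L G} {N : G → ℝ} (hN : IsHomogeneousNorm S e N)
  [TopologicalSpace L] [IsTopologicalAddGroup L] [ContinuousSMul ℝ L] [T2Space L]
  [FiniteDimensional ℝ L]

include hN

theorem exists_closure_inter_le (hsurj : Function.Surjective e.exp)
    (hinj : ∀ X : L, (∀ t : ℝ, e.exp (t • X) = 1) → X = 0) :
    ∃ c : ℕ, ∀ (H : Subgroup G) (j k : ℤ),
      LieSubalgebra.lieSpan ℝ L {X | e.exp X ∈ (H : Set G) ∩ {x | N x ≤ (2 : ℝ) ^ j}} ≤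
        LieSubalgebra.lieSpan ℝ L {X | e.exp X ∈ (H : Set G) ∩ {x | N x ≤ (2 : ℝ) ^ k}} →
      Subgroup.closure ((H : Set G) ∩ {x | N x ≤ (2 : ℝ) ^ j}) ≤
        Subgroup.closure ((H : Set G) ∩ {x | N x ≤ (2 : ℝ) ^ (k + c)}) := by
  obtain ⟨K, hK⟩ := hN.exists_covering_constant S.filtration hinj
  obtain ⟨c, hc⟩ := pow_unbounded_of_one_lt K (one_lt_two (α := ℝ))
  refine ⟨c, fun H j k hjk => (Subgroup.closure_le _).2 fun x hx => ?_⟩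
  obtain ⟨X, rfl⟩ := hsurj x
  have h2k : (0 : ℝ) ≤ 2 ^ k := by positivity
  obtain ⟨γ, hγ, hγN⟩ := hK ((H : Set G) ∩ {x | N x ≤ (2 : ℝ) ^ k}) (2 ^ k) h2k
    (fun a ha => ha.2) X (hjk (LieSubalgebra.subset_lieSpan hx))
  have hle : (2 : ℝ) ^ k ≤ 2 ^ (k + c) := zpow_le_zpow_right₀ one_le_two (by omega)
  have hγH : γ ∈ H := (Subgroup.closure_le H).2 Set.inter_subset_left hγ
  have hxγ : N (γ⁻¹ * e.exp X) ≤ (2 : ℝ) ^ (k + (c : ℤ)) := by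
    refine hγN.trans ?_
    rw [zpow_add₀ two_ne_zero, mul_comm, zpow_natCast]
    exact mul_le_mul_of_nonneg_left hc.le h2k
  have hsub : (H : Set G) ∩ {x | N x ≤ (2 : ℝ) ^ k} ⊆
      (H : Set G) ∩ {x | N x ≤ (2 : ℝ) ^ (k + (c : ℤ))} :=
    fun y hy => ⟨hy.1, (show N y ≤ (2 : ℝ) ^ k from hy.2).trans hle⟩
  have hmem : γ⁻¹ * e.exp X ∈ (H : Set G) ∩ {x | N x ≤ (2 : ℝ) ^ (k + (c : ℤ))} :=
    ⟨H.mul_mem (H.inv_mem hγH) hx.1, hxγ⟩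
  have h := mul_mem (Subgroup.closure_mono hsub hγ) (Subgroup.subset_closure hmem)
  rwa [mul_inv_cancel_left] at h

/-- The group at scale `k` depends only on the dimensions of the subalgebras at the scales `k - c`
and `k` and on `k` modulo `c + 1`. -/
theorem exists_encard_range_le (hsurj : Function.Surjective e.exp)
    (hinj : ∀ X : L, (∀ t : ℝ, e.exp (t • X) = 1) → X = 0) :
    ∃ B : ℕ, ∀ H : Subgroup G, (Set.range fun k : ℤ =>
      Subgroup.closure ((H : Set G) ∩ {x | N x ≤ (2 : ℝ) ^ k})).encard ≤ B := by
  obtain ⟨c, hc⟩ := hN.exists_closure_inter_le hsurj hinj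
  let D := Module.finrank ℝ L
  refine ⟨(Set.univ : Set (Fin (D + 1) × Fin (D + 1) × ZMod (c + 1))).toFinite.toFinset.card,
    fun H => ?_⟩
  let A : ℤ → Set G := fun k => (H : Set G) ∩ {x | N x ≤ (2 : ℝ) ^ k}
  let n : ℤ → LieSubalgebra ℝ L := fun k => LieSubalgebra.lieSpan ℝ L {X | e.exp X ∈ A k}
  have hA : Monotone A := fun j k hjk => fun y hy =>
    ⟨hy.1, (show N y ≤ (2 : ℝ) ^ j from hy.2).trans (zpow_le_zpow_right₀ one_le_two hjk)⟩
  have hn : Monotone n := fun j k hjk => LieSubalgebra.lieSpan_mono fun X hX => hA hjk hX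
  let δ : ℤ → ℕ := fun k => Module.finrank ℝ (n k).toSubmodule
  have hδ : Monotone δ := fun j k hjk => Submodule.finrank_mono (hn hjk)
  have hδn : ∀ {j k}, δ j = δ k → k ≤ j → n j = n k := fun {j k} h hkj =>
    LieSubalgebra.toSubmodule_injective (Submodule.eq_of_le_of_finrank_eq (hn hkj) h.symm).symm
  let color : ℤ → Fin (D + 1) × Fin (D + 1) × ZMod (c + 1) := fun k =>
    (⟨δ (k - c), Nat.lt_succ_of_le (Submodule.finrank_le _)⟩,
      ⟨δ k, Nat.lt_succ_of_le (Submodule.finrank_le _)⟩, (k : ZMod (c + 1)))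
  have hcolor : ∀ j k, k ≤ j → color j = color k →
      Subgroup.closure (A j) = Subgroup.closure (A k) := by
    intro j k hkj h
    simp only [color, Prod.mk.injEq, Fin.mk.injEq] at h
    obtain ⟨h1, h2, h3⟩ := h
    -- Equal dimensions at `k - c` and `k` mean that the subalgebra is constant from `k - c` to `j`;
    -- otherwise `j - k ≤ c`, and the residues modulo `c + 1` give `j = k`.
    rcases (hδ (show k - c ≤ k by omega)).eq_or_lt with h4 | h4
    · have hjk : n j = n (k - c) := hδn (h2.trans h4.symm) (by omega)
      refine le_antisymm ?_ (Subgroup.closure_mono (hA hkj))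
      have := hc H j (k - c) hjk.le
      rwa [sub_add_cancel] at this
    · have hlt : j - c < k := by
        by_contra! h
        have := hδ h
        omega
      rw [ZMod.intCast_eq_intCast_iff_dvd_sub] at h3
      have : k - j = 0 := Int.eq_zero_of_abs_lt_dvd h3 (by
        rw [abs_lt]; push_cast; constructor <;> omega)
      rw [show j = k by omega]
  have hfac : Function.FactorsThrough (fun k => Subgroup.closure (A k)) color := by
    intro j k h
    rcases le_total k j with hkj | hkj
    · exact hcolor j k hkj h
    · exact (hcolor k j hkj h.symm).symm
  change (Set.range fun k => Subgroup.closure (A k)).encard ≤ _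
  rw [← hfac.extend_comp (fun _ => ⊥), Set.range_comp]
  refine (Set.encard_image_le _ _).trans ((Set.encard_le_encard (Set.subset_univ _)).trans ?_)
  exact (Set.Finite.encard_eq_coe_toFinset_card _).le

end IsHomogeneousNorm

/-! ### The exponential map of a Lie group -/

section LieGroupExp

variable (E : Type*) [NormedAddCommGroup E] [NormedSpace ℝ E]
  (G : Type*) [TopologicalSpace G] [ChartedSpace E G] [Group G]

instance finiteDimensional_groupLieAlgebra [FiniteDimensional ℝ E] :
    FiniteDimensional ℝ (GroupLieAlgebra 𝓘(ℝ, E) G) :=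
  inferInstanceAs (FiniteDimensional ℝ E)

instance t2Space_groupLieAlgebra : T2Space (GroupLieAlgebra 𝓘(ℝ, E) G) :=
  inferInstanceAs (T2Space E)

variable [LieGroup 𝓘(ℝ, E) ∞ G] [T2Space G] [FiniteDimensional ℝ E] [CompleteSpace E]

/-- The exponential calculus of a Lie group. -/
noncomputable def lieExpCalculus : ExpCalculus (GroupLieAlgebra 𝓘(ℝ, E) G) G where
  exp := lieExp
  Ad g := (lieAd (E := E) g).toLinearMap
  LogDeriv g ξ := HasLogDeriv (E := E) g ξ
  exp_zero := modelExp_zero (E := E) (G := G)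
  exp_add_smul := modelExp_add_smul (E := E) (G := G)
  exp_Ad := modelExp_lieAd (E := E) (G := G)
  Ad_one := lieAd_one (E := E) (G := G)
  hasDerivAt_Ad X Y l t :=
    (LinearMap.toContinuousLinearMap (show E →ₗ[ℝ] ℝ from l)).hasFDerivAt.comp_hasDerivAt t
      (hasDerivAt_lieAd_modelExp (E := E) (G := G) X Y t)
  logDeriv_mul hg hh := HasLogDeriv.mul hg hh
  logDeriv_exp X hc := (hasLogDeriv_modelExp (E := E) (G := G) X).comp_real hc
  eq_of_logDeriv_zero hg t := HasLogDeriv.eq_const hg t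

/-- The image of the exponential map is a subgroup that contains a neighbourhood of the identity. -/
theorem surjective_lieExp [PreconnectedSpace G]
    (Φ : NilpotentFiltration (GroupLieAlgebra 𝓘(ℝ, E) G)) :
    Function.Surjective (lieExp : GroupLieAlgebra 𝓘(ℝ, E) G → G) := by
  have : IsTopologicalGroup G := topologicalGroup_of_lieGroup 𝓘(ℝ, E) ∞
  let e := lieExpCalculus E G
  let K : Subgroup G := Subgroup.closure (e.exp '' (⊤ : Submodule ℝ (GroupLieAlgebra 𝓘(ℝ, E) G)))
  have hnhds : (K : Set G) ∈ 𝓝 (1 : G) := by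
    filter_upwards [eventually_exists_hasLogDeriv (G := G) E] with g hg
    obtain ⟨c, ξ, T, hc0, hcT, hc, hξ⟩ := hg
    have hξ' : Continuous (Y := GroupLieAlgebra 𝓘(ℝ, E) G) ξ := hξ
    obtain ⟨Z, hZ⟩ := e.exists_exp_eq_of_logDeriv Φ (g := c) hc hξ' hc0 T
    rw [← hcT, ← hZ]
    exact Subgroup.subset_closure ⟨Z, Submodule.mem_top, rfl⟩
  have hopen : IsOpen (K : Set G) := K.isOpen_of_mem_nhds hnhds
  have huniv : (K : Set G) = Set.univ :=
    IsClopen.eq_univ ⟨K.isClosed_of_isOpen hopen, hopen⟩ ⟨1, K.one_mem⟩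
  intro x
  have hx : x ∈ K := by rw [← SetLike.mem_coe, huniv]; trivial
  obtain ⟨Z, -, hZ⟩ := e.exists_exp_eq_of_mem_closure Φ (fun _ _ _ _ => Submodule.mem_top) hx
  exact ⟨Z, hZ⟩

end LieGroupExp

theorem IsHomogeneousMetric.isHomogeneousNorm {E : Type*} [NormedAddCommGroup E] [NormedSpace ℝ E]
    [FiniteDimensional ℝ E] [CompleteSpace E] {G : Type*} [TopologicalSpace G] [T2Space G]
    [ChartedSpace E G] [Group G] [LieGroup 𝓘(ℝ, E) ∞ G]
    {S : LieStratification (GroupLieAlgebra 𝓘(ℝ, E) G)} {d : G → G → ℝ}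
    (hd : IsHomogeneousMetric S d) :
    IsHomogeneousNorm S (lieExpCalculus E G) fun x => d 1 x where
  eq_zero_iff x := (hd.eq_zero_iff 1 x).trans eq_comm
  inv x := by
    have := hd.left_invariant 1 x⁻¹ x
    rw [mul_one, mul_inv_cancel] at this
    rw [← this, hd.symm]
  mul_le x y := by
    have := hd.left_invariant 1 y x
    rw [mul_one] at this
    rw [← this]
    exact hd.triangle 1 x (x * y)
  dilation t ht X := by
    have h := hd.homogeneous t ht 0 X
    have h0 : (lieExp (0 : GroupLieAlgebra 𝓘(ℝ, E) G) : G) = 1 := modelExp_zero (E := E) (G := G)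
    have hS : S.dilation t 0 = 0 := by simpa using S.dilation_smul t 0 0
    rwa [hS, h0] at h

theorem proposition5p1
    {E : Type*} [NormedAddCommGroup E] [NormedSpace ℝ E] [FiniteDimensional ℝ E] [CompleteSpace E]
    {G : Type*} [TopologicalSpace G] [T2Space G] [SecondCountableTopology G] [ChartedSpace E G]
    [Group G] [LieGroup 𝓘(ℝ, E) ∞ G] [SimplyConnectedSpace G] [Group.IsNilpotent G]
    (S : LieStratification (GroupLieAlgebra 𝓘(ℝ, E) G))
    (d : G → G → ℝ) (hd : IsHomogeneousMetric S d) :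
    (⨆ H : {H : Subgroup G // DiscreteTopology H},
      (Set.range fun k : ℤ =>
        Subgroup.closure ((H : Set G) ∩ {x : G | d 1 x ≤ (2 : ℝ) ^ k})).encard) < ⊤ := by
  have hinj : ∀ X : GroupLieAlgebra 𝓘(ℝ, E) G, (∀ t : ℝ, (lieExp (t • X) : G) = 1) → X = 0 :=
    fun X hX => eq_zero_of_modelExp_smul_eq_one (E := E) hX
  obtain ⟨B, hB⟩ := hd.isHomogeneousNorm.exists_encard_range_le
    (surjective_lieExp E G S.filtration) hinj
  refine lt_of_le_of_lt (iSup_le fun H => ?_) (ENat.natCast_lt_top B)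
  exact hB H.1
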